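/- Let $d\in\{2,3\}$, let $\Omega\subset\mathbb{R}^d$ be a bounded domain, $Y=[0,1]^d$, and let $Y_s\subset Y$ be closed and such that $\mathbb{R}^d\setminus\bigcup_{k\in\mathbb{Z}^d}(Y_s+k)$ is connected; put $Y_l=Y\setminus Y_s$ (the fluid part of the cell). Let $\mathbf{A}=(a_{ij}):\mathbb{R}^d\to\mathbb{R}^{d\times d}$ be essentially bounded, $Y$-periodic, symmetric, globally Lipschitz and uniformly elliptic ($\underline{\gamma}|\xi|^2\le \mathbf{A}(y)\xi\cdot\xi\le\overline{\gamma}|\xi|^2$ with $\underline{\gamma},\overline{\gamma}>0$). For $1\le i\le d$ let $\chi_i\in H^1_\#(Y_l)$ ($H^1$, $Y$-periodic, zero mean) be the weak solution of the cell problem $$\nabla\cdot(-\mathbf{A}(\nabla\chi_i+e_i))=0 \text{ in } Y_l,\qquad \mathbf{A}(\nabla\chi_i+e_i)\cdot \mathrm{n}=0 \text{ on } \partial Y_s,\qquad \chi_i \text{ periodic},$$ and let $A^0=(a^0_{ij})$, $a^0_{ij}=\int_{Y_l}\sum_k a_{ik}\,(\partial_k\chi_j+\delta_{kj})\,dy$,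 be the homogenized matrix. Let $\mathcal{R}:\mathbb{R}\to\mathbb{R}$ be degenerate at a point $x_0$ with constants $\delta_0,\delta_1>0$, that is: $0\le\mathcal{R}'\le\delta_1$ a.e.; if $\lim_{x\to s^+}\mathcal{R}'(x)\cdot\lim_{x\to s^-}\mathcal{R}'(x)=0$ then $s=x_0$; and $\delta_0\le\mathcal{R}'\le\delta_1$ a.e. outside some ball centred at $x_0$. Let $f\in C^\infty(\overline{\Omega})$, $\eta>0$, $\sigma>1$, and $\gamma_k=c/(k+1)$ for $k\ge1$, with some constant $c>0$. Let $\mathcal{R}_{\gamma_k}\in C^\infty(\mathbb{R})$, $k\ge 1$, be regularizations of $\mathcal{R}$ of order $\sigma$, i.e. for some constant $K$ and all $k\ge1$, $x\in\mathbb{R}$, $$0<\gamma_k\delta_0\le \mathcal{R}_{\gamma_k}'(x)\le\delta_1,\qquad |\mathcal{R}(x)-\mathcal{R}_{\gamma_k}(x)|\le K\gamma_k^\sigma .$$ Let $u_0^0=0$ and, for $k\ge1$, let $u_0^k\in H^1_0(\Omega)$ be the weak solution of the macroscopic linearized problem (case $\alpha=0$) $$\nabla\cdot(-A^0\nabla u_0^k)+(\eta+\delta_1)|Y_l|u_0^k=|Y_l|f+(\eta+\delta_1)|Y_l|u_0^{k-1}-|Y_l|\,\mathcal{R}_{\gamma_k}(u_0^{k-1})\quad\text{in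 }\Omega,\qquad u_0^k=0\text{ on }\partial\Omega.$$ Then there is a constant $C>0$, independent of $k$, such that for all $k\ge1$ $$\|u_0^k-u_0^{k-1}\|_{L^\infty(\Omega)}\le\frac{C}{(k+1)^{\sigma-1}} .$$ -/

import Mathlib

open MeasureTheory Filter Topology
open scoped ContDiff NNReal ENNReal

noncomputable section

namespace MacroScheme

/-- Euclidean space of dimension `d`. -/
abbrev E (d : ℕ) : Type := EuclideanSpace ℝ (Fin d)

/-! ### Sobolev spaces -/

/-- Smooth functions with compact support contained in `U`. -/
def IsTestFunction {d : ℕ} (U : Set (E d)) (φ : E d → ℝ) : Prop :=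
  ContDiff ℝ ∞ φ ∧ HasCompactSupport φ ∧ tsupport φ ⊆ U

/-- `g` is the weak gradient of `u` on the open set `U`. -/
def HasWeakGradient {d : ℕ} (U : Set (E d)) (u : E d → ℝ) (g : E d → E d) : Prop :=
  LocallyIntegrableOn u U volume ∧ LocallyIntegrableOn g U volume ∧
    ∀ φ : E d → ℝ, IsTestFunction U φ → ∀ i : Fin d,
      ∫ x in U, u x * gradient φ x i = - ∫ x in U, g x i * φ x

/-- `u ∈ H¹₀(Ω)` with (weak) gradient `g`: the pair `(u, g)` is the limit in `L²(Ω) × L²(Ω)^d`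
of pairs `(φₙ, ∇φₙ)` with `φₙ ∈ C_c^∞(Ω)`, i.e. `u` is in the `H¹`-closure of `C_c^∞(Ω)`. -/
def MemH10 {d : ℕ} (Ω : Set (E d)) (u : E d → ℝ) (g : E d → E d) : Prop :=
  MemLp u 2 (volume.restrict Ω) ∧ MemLp g 2 (volume.restrict Ω) ∧
    ∃ φ : ℕ → E d → ℝ, (∀ n, IsTestFunction Ω (φ n)) ∧
      Tendsto (fun n => eLpNorm (fun x => u x - φ n x) 2 (volume.restrict Ω)) atTop (𝓝 0) ∧
      Tendsto (fun n => eLpNorm (fun x => g x - gradient (φ n) x) 2 (volume.restrict Ω))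
        atTop (𝓝 0)

/-! ### The periodicity cell and the cell problems -/

/-- The integer vector `k`, as a point of `ℝ^d`. -/
def latticeVec {d : ℕ} (k : Fin d → ℤ) : E d := WithLp.toLp 2 (fun i => (k i : ℝ))

/-- `Y`-periodicity, `Y = [0,1]^d`. -/
def IsPeriodic {d : ℕ} {α : Type*} (h : E d → α) : Prop :=
  ∀ (y : E d) (k : Fin d → ℤ), h (y + latticeVec k) = h y

/-- The unit cell `Y = [0,1]^d`. -/
def unitCell (d : ℕ) : Set (E d) := {y | ∀ i, 0 ≤ y i ∧ y i ≤ 1}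

/-- The periodic fluid region: the complement of all integer translates of the solid part `Ys`. -/
def periodicFluid {d : ℕ} (Ys : Set (E d)) : Set (E d) :=
  {y | ∀ k : Fin d → ℤ, y + latticeVec k ∉ Ys}

/-- The fluid part `Y_l` of the cell; it is `Y \ Ys` up to a null subset of the faces of `Y`. -/
def fluidCell {d : ℕ} (Ys : Set (E d)) : Set (E d) := unitCell d ∩ periodicFluid Ys

/-- An admissible cell geometry: the solid part is a closed subset of `Y`, and the fluid
region is connected. -/
structure IsAdmissibleCell {d : ℕ} (Ys : Set (E d)) : Prop where
  isClosed : IsClosed Ys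
  subset : Ys ⊆ unitCell d
  connected : IsConnected (periodicFluid Ys)

/-- `χ ∈ H¹_#(Y_l)` with weak gradient `g`: periodic, of class `H¹`, with zero mean. -/
structure MemPeriodicH1 {d : ℕ} (Ys : Set (E d)) (χ : E d → ℝ) (g : E d → E d) : Prop where
  periodic : IsPeriodic χ
  periodic_grad : IsPeriodic g
  memLp : MemLp χ 2 (volume.restrict (fluidCell Ys))
  memLp_grad : MemLp g 2 (volume.restrict (fluidCell Ys))
  weakGradient : HasWeakGradient (periodicFluid Ys) χ g
  zero_mean : ∫ y in fluidCell Ys, χ y = 0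

/-- The assumptions on the diffusion matrix: essentially bounded, periodic, symmetric,
globally Lipschitz, uniformly elliptic. -/
structure IsDiffusion {d : ℕ} (A : E d → Matrix (Fin d) (Fin d) ℝ) : Prop where
  bounded : ∃ B : ℝ, ∀ i j, ∀ᵐ y ∂(volume : Measure (E d)), |A y i j| ≤ B
  periodic : IsPeriodic A
  symm : ∀ y, (A y).IsSymm
  lipschitz : ∀ i j, ∃ K : ℝ≥0, LipschitzWith K (fun y => A y i j)
  elliptic : ∃ lo > (0 : ℝ), ∃ hi > (0 : ℝ), ∀ (y ξ : E d),
    lo * ‖ξ‖ ^ 2 ≤ ∑ i, ∑ j, A y i j * ξ i * ξ j ∧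
      ∑ i, ∑ j, A y i j * ξ i * ξ j ≤ hi * ‖ξ‖ ^ 2

/-- `χ`, with weak gradient `g`, is the weak solution in `H¹_#(Y_l)` of the `i`-th cell problem
`∇·(-A(∇χ + eᵢ)) = 0` in `Y_l`, `-A(∇χ + eᵢ)·n = 0` on `Γ`, `χ` periodic. -/
def IsCellSolution {d : ℕ} (A : E d → Matrix (Fin d) (Fin d) ℝ) (Ys : Set (E d)) (i : Fin d)
    (χ : E d → ℝ) (g : E d → E d) : Prop :=
  MemPeriodicH1 Ys χ g ∧
    ∀ (ψ : E d → ℝ) (h : E d → E d), MemPeriodicH1 Ys ψ h →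
      ∫ y in fluidCell Ys,
        ∑ k, ∑ l, A y k l * (g y l + (if l = i then 1 else 0)) * h y k = 0

/-- The homogenized matrix `a⁰_{ij} = ∫_{Y_l} (A (∇χ_j + e_j))_i dy`; here `g j = ∇χ_j`. -/
def homogenized {d : ℕ} (A : E d → Matrix (Fin d) (Fin d) ℝ) (Ys : Set (E d))
    (g : Fin d → E d → E d) : Matrix (Fin d) (Fin d) ℝ :=
  fun i j => ∫ y in fluidCell Ys, ∑ k, A y i k * (g j y k + (if k = j then 1 else 0))

/-! ### Degenerate reactions and their regularizations -/

/-- `F` is degenerate at `x₀` with constants `δ₀`, `δ₁`: `0 ≤ F' ≤ δ₁` a.e.; the product of the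
one-sided limits of `F'` (along points of differentiability) vanishes at most at `x₀`; and
`δ₀ ≤ F' ≤ δ₁` a.e. off some ball around `x₀`. -/
structure IsDegenerateAt (F : ℝ → ℝ) (x₀ δ₀ δ₁ : ℝ) : Prop where
  pos₁ : 0 < δ₁
  pos₀ : 0 < δ₀
  deriv_mem : ∀ᵐ x : ℝ, DifferentiableAt ℝ F x ∧ 0 ≤ deriv F x ∧ deriv F x ≤ δ₁
  degenerate_only : ∀ s a b : ℝ,
    Tendsto (deriv F) (𝓝[Set.Ioi s ∩ {x | DifferentiableAt ℝ F x}] s) (𝓝 a) →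
    Tendsto (deriv F) (𝓝[Set.Iio s ∩ {x | DifferentiableAt ℝ F x}] s) (𝓝 b) →
    a * b = 0 → s = x₀
  nondegenerate_off : ∃ r > (0 : ℝ), ∀ᵐ x : ℝ, x ∉ Metric.ball x₀ r →
    δ₀ ≤ deriv F x ∧ deriv F x ≤ δ₁

/-- `G` is a regularization `F_γ` of `F`, of order `σ` and with constant `K`. -/
structure IsRegularization (F : ℝ → ℝ) (δ₀ δ₁ σ K γ : ℝ) (G : ℝ → ℝ) : Prop where
  differentiable : Differentiable ℝ G
  pos : 0 < γ * δ₀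
  le_deriv : ∀ x, γ * δ₀ ≤ deriv G x
  deriv_le : ∀ x, deriv G x ≤ δ₁
  approx : ∀ x, |F x - G x| ≤ K * γ ^ σ

/-! ### The macroscopic iteration, case `α = 0` -/

/-- `u⁰ = 0`, and for `k ≥ 1` the function `u^k ∈ H¹₀(Ω)` is the weak solution of
`∇·(-A⁰∇u^k) + M|Y_l| u^k = |Y_l| f + M|Y_l| u^{k-1} - |Y_l| 𝓡_k(u^{k-1})`. Here `m = |Y_l|`,
`M = η + δ₁` and `Rk k = 𝓡_{γ_k}`. -/
def IsMacroIteration {d : ℕ} (Ω : Set (E d)) (A0 : Matrix (Fin d) (Fin d) ℝ) (m M : ℝ)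
    (f : E d → ℝ) (Rk : ℕ → ℝ → ℝ) (u : ℕ → E d → ℝ) : Prop :=
  u 0 =ᵐ[volume.restrict Ω] 0 ∧
    ∀ k : ℕ, 1 ≤ k → ∃ g : E d → E d, MemH10 Ω (u k) g ∧
      ∀ (φ : E d → ℝ) (h : E d → E d), MemH10 Ω φ h →
        (∫ x in Ω, ∑ i, ∑ j, A0 i j * g x j * h x i) + M * m * ∫ x in Ω, u k x * φ x
          = m * (∫ x in Ω, f x * φ x) + M * m * (∫ x in Ω, u (k - 1) x * φ x)
            - m * ∫ x in Ω, Rk k (u (k - 1) x) * φ x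

end MacroScheme

end

namespace MacroScheme

/-! ### Geometry of the periodic fluid region -/

/-! Put `M = η + δ₁`, `m = |Y_l|` and `κ = M m`. The difference of two consecutive iterates lies in
`H¹₀(Ω)` and solves `-∇·(A⁰∇w) + κ w = F`. Since `M ≥ δ₁`, the map `t ↦ M t - 𝓡_γ(t)` has slope in
`[0, M]`, so `|F|` is at most `κ` times the sup norm of the previous difference, plus `m` times the
error of exchanging one regularization for the next. Comparing both with `𝓡` bounds that error by a
multiple of `(k+1)^(-σ)`.

The plain maximum principle would only give contraction factor 1. On a bounded domain a barrier in a
single coordinate improves it to some `ρ < 1` depending only on `Ω`, `A⁰` and `κ`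
(`exists_contraction`, via `IsWeakSolution.le_supersolution` and `exists_barrier_profile`). The sup
norms then satisfy `b (k+1) ≤ ρ (b k + D/(k+1)^σ)`, which forces the stated decay
(`exists_le_div_rpow_of_recursion`).

The barrier needs little of `A⁰`: a nonnegative quadratic form and one positive diagonal entry. Both
follow by writing `A⁰` as the Gram matrix of the fields `∇χᵢ + eᵢ` in the energy product. A zero
diagonal entry would mean `∇χᵢ = -eᵢ`, so `χᵢ + yᵢ` would be constant on the connected fluid region,
against the periodicity of `χᵢ` (`not_ae_weakGradient_eq_neg_single`). -/

lemma latticeVec_neg {d : ℕ} (k : Fin d → ℤ) : latticeVec (-k) = -latticeVec k := by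
  ext i; simp [latticeVec]

lemma latticeVec_add {d : ℕ} (k l : Fin d → ℤ) :
    latticeVec (k + l) = latticeVec k + latticeVec l := by
  ext i; simp [latticeVec]

lemma latticeVec_single {d : ℕ} (i : Fin d) :
    latticeVec (Pi.single i 1) = EuclideanSpace.single i (1 : ℝ) := by
  ext j
  by_cases h : j = i
  · subst h; simp [latticeVec]
  · simp [latticeVec, h]

lemma isClosed_range_latticeVec (d : ℕ) :
    IsClosed (Set.range (latticeVec : (Fin d → ℤ) → E d)) := by
  have : Set.range (latticeVec : (Fin d → ℤ) → E d)
      = ⋂ i, {x : E d | x i ∈ Set.range ((↑) : ℤ → ℝ)} := by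
    ext x
    simp only [Set.mem_range, Set.mem_iInter, Set.mem_ofPred_eq]
    constructor
    · rintro ⟨k, rfl⟩ i
      exact ⟨k i, rfl⟩
    · intro h
      choose k hk using h
      exact ⟨k, by ext i; exact hk i⟩
  rw [this]
  refine isClosed_iInter fun i => ?_
  exact Int.isClosedEmbedding_coe_real.isClosed_range.preimage
    (EuclideanSpace.proj (𝕜 := ℝ) i).continuous

lemma isClosed_unitCell (d : ℕ) : IsClosed (unitCell d) := by
  have : unitCell d = ⋂ i, ({x : E d | 0 ≤ x i} ∩ {x | x i ≤ 1}) := by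
    ext; simp [unitCell]
  rw [this]
  refine isClosed_iInter fun i => ?_
  have hc : Continuous fun x : E d => x i := (EuclideanSpace.proj (𝕜 := ℝ) i).continuous
  exact (isClosed_le continuous_const hc).inter (isClosed_le hc continuous_const)

lemma isBounded_unitCell (d : ℕ) : Bornology.IsBounded (unitCell d) := by
  refine (Metric.isBounded_iff_subset_closedBall 0).2 ⟨√d, fun x hx => ?_⟩
  rw [mem_closedBall_zero_iff, EuclideanSpace.norm_eq]
  refine Real.sqrt_le_sqrt ?_
  calc ∑ i, ‖x i‖ ^ 2 ≤ ∑ _i : Fin d, (1 : ℝ) := by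
        refine Finset.sum_le_sum fun i _ => ?_
        obtain ⟨h0, h1⟩ := hx i
        rw [Real.norm_eq_abs, sq_abs]
        nlinarith
    _ = d := by simp

lemma isCompact_unitCell (d : ℕ) : IsCompact (unitCell d) :=
  Metric.isCompact_of_isClosed_isBounded (isClosed_unitCell d) (isBounded_unitCell d)

-- The union of all translates of the solid is the Minkowski sum of a compact set and the closed
-- integer lattice, hence closed.
open scoped Pointwise in
lemma isOpen_periodicFluid {d : ℕ} {Ys : Set (E d)} (h : IsAdmissibleCell Ys) :
    IsOpen (periodicFluid Ys) := by
  have hc : IsCompact Ys := (isCompact_unitCell d).of_isClosed_subset h.isClosed h.subset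
  have : periodicFluid Ys = (Ys + Set.range (latticeVec : (Fin d → ℤ) → E d))ᶜ := by
    ext y
    simp only [periodicFluid, Set.mem_ofPred_eq, Set.mem_compl_iff, Set.mem_add, Set.mem_range]
    constructor
    · rintro hy ⟨a, ha, b, ⟨k, rfl⟩, rfl⟩
      refine hy (-k) ?_
      rw [latticeVec_neg]
      simpa using ha
    · rintro hy k hk
      exact hy ⟨_, hk, _, ⟨-k, rfl⟩, by rw [latticeVec_neg]; simp⟩
  rw [this, isOpen_compl_iff]
  exact (isClosed_range_latticeVec d).add_left_of_isCompact hc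

lemma add_latticeVec_mem_periodicFluid {d : ℕ} {Ys : Set (E d)} {y : E d}
    (hy : y ∈ periodicFluid Ys) (k : Fin d → ℤ) : y + latticeVec k ∈ periodicFluid Ys := by
  intro l
  rw [add_assoc, ← latticeVec_add]
  exact hy _

lemma exists_add_latticeVec_mem_unitCell {d : ℕ} (y : E d) :
    ∃ k : Fin d → ℤ, y + latticeVec k ∈ unitCell d := by
  refine ⟨fun i => -⌊y i⌋, fun i => ?_⟩
  have : (y + latticeVec fun i => -⌊y i⌋) i = Int.fract (y i) := by
    simp [latticeVec, Int.fract, sub_eq_add_neg]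
  rw [this]
  exact ⟨Int.fract_nonneg _, (Int.fract_lt_one _).le⟩

/-- A periodic property that holds almost everywhere in the fluid part of the cell holds almost
everywhere in the periodic fluid region. -/
lemma volume_periodicFluid_inter_eq_zero {d : ℕ} {Ys P : Set (E d)}
    (hP : ∀ y ∈ P, ∀ k : Fin d → ℤ, y + latticeVec k ∈ P)
    (h : volume (fluidCell Ys ∩ P) = 0) : volume (periodicFluid Ys ∩ P) = 0 := by
  have hsub : periodicFluid Ys ∩ P ⊆
      ⋃ k : Fin d → ℤ, (fun y => y + latticeVec k) ⁻¹' (fluidCell Ys ∩ P) := by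
    rintro y ⟨hy, hyP⟩
    obtain ⟨k, hk⟩ := exists_add_latticeVec_mem_unitCell y
    exact Set.mem_iUnion.2 ⟨k, ⟨hk, add_latticeVec_mem_periodicFluid hy k⟩, hP y hyP k⟩
  refine measure_mono_null hsub (measure_iUnion_null fun k => ?_)
  rw [measure_preimage_add_right, h]

lemma measurableSet_fluidCell {d : ℕ} {Ys : Set (E d)} (h : IsAdmissibleCell Ys) :
    MeasurableSet (fluidCell Ys) :=
  (isClosed_unitCell d).measurableSet.inter (isOpen_periodicFluid h).measurableSet

lemma volume_fluidCell_lt_top {d : ℕ} (Ys : Set (E d)) : volume (fluidCell Ys) < ⊤ :=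
  (measure_mono Set.inter_subset_left).trans_lt (isCompact_unitCell d).measure_lt_top

/-- Otherwise the periodic fluid region, covered by countably many translates of the cell, would be
a nonempty open null set. -/
lemma volume_real_fluidCell_pos {d : ℕ} {Ys : Set (E d)} (h : IsAdmissibleCell Ys) :
    0 < volume.real (fluidCell Ys) := by
  refine ENNReal.toReal_pos (fun h0 => ?_) (volume_fluidCell_lt_top Ys).ne
  have := volume_periodicFluid_inter_eq_zero (P := Set.univ) (Ys := Ys) (by simp) (by simpa using h0)
  rw [Set.inter_univ] at this
  exact ((isOpen_periodicFluid h).measure_pos volume h.connected.nonempty).ne' this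

lemma gradient_apply {d : ℕ} (φ : E d → ℝ) (x : E d) (i : Fin d) :
    gradient φ x i = fderiv ℝ φ x (EuclideanSpace.single i 1) := by
  have h : inner ℝ (gradient φ x) (EuclideanSpace.single i (1 : ℝ))
      = fderiv ℝ φ x (EuclideanSpace.single i 1) := by
    simp [gradient]
  rw [← h, EuclideanSpace.inner_single_right]
  simp

/-- No periodic function on the fluid region has the constant weak gradient `-eᵢ`. -/
lemma not_ae_weakGradient_eq_neg_single {d : ℕ} {Ys : Set (E d)} (hYs : IsAdmissibleCell Ys)
    {χ : E d → ℝ} {g : E d → E d} (hper : IsPeriodic χ)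
    (hw : HasWeakGradient (periodicFluid Ys) χ g) (i : Fin d)
    (hg : ∀ᵐ y ∂volume.restrict (periodicFluid Ys), g y = -EuclideanSpace.single i (1 : ℝ)) :
    False := by
  set U := periodicFluid Ys with hU
  have hUo : IsOpen U := isOpen_periodicFluid hYs
  set e : E d := EuclideanSpace.single i (1 : ℝ) with he
  obtain ⟨y₀, hy₀⟩ := hYs.connected.nonempty
  have hy₁ : y₀ + e ∈ U := by
    rw [he, ← latticeVec_single]; exact add_latticeVec_mem_periodicFluid hy₀ _
  -- Connectedness enters here: a path inside the fluid joins `y₀` to its translate by `eᵢ`. A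
  -- mollification of `χ` is followed along it, inside a compact neighbourhood `K` of the path.
  obtain ⟨p, hp⟩ := (hUo.isConnected_iff_isPathConnected.1 hYs.connected).joinedIn y₀ hy₀ _ hy₁
  have hPc : IsCompact (Set.range p) := isCompact_range p.continuous
  obtain ⟨ε, hε, hεU⟩ := hPc.exists_cthickening_subset_open hUo
    (Set.range_subset_iff.2 hp)
  set K := Metric.cthickening ε (Set.range p)
  have hKc : IsCompact K := hPc.cthickening
  let φ : ContDiffBump (0 : E d) := ⟨ε / 4, ε / 2, by positivity, by linarith⟩
  have hφs : tsupport φ = Metric.closedBall (0 : E d) (ε / 2) := φ.tsupport_eq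
  have hφint : 0 < ∫ x, φ x := φ.integral_pos
  -- Cutting off outside `K` makes `χ` locally integrable on the whole space. The mollification at
  -- points of the path only sees `K`, so nothing changes there.
  set v : E d → ℝ := K.indicator χ
  have hv : LocallyIntegrable v := by
    have : IntegrableOn χ K := hw.1.integrableOn_compact_subset hεU hKc
    exact (this.integrable_indicator hKc.measurableSet).locallyIntegrable
  set F : E d → ℝ := fun y => ∫ z, v z * φ (y - z)
  have hF : F = convolution v φ (ContinuousLinearMap.mul ℝ ℝ) volume := rfl
  have hφd : ContDiff ℝ ∞ φ := φ.contDiff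
  -- The derivative falls on the bump, whose reflected translate is a test function in `U`. The weak
  -- gradient `-eᵢ` then yields the constant derivative; the factor `∫ φ` appears because `φ` is not
  -- normalized.
  have hder : ∀ y, Metric.closedBall y (ε / 2) ⊆ K →
      HasFDerivAt F (-(∫ x, φ x) • (EuclideanSpace.proj i : E d →L[ℝ] ℝ)) y := by
    intro y hy
    have h1 := φ.hasCompactSupport.hasFDerivAt_convolution_right (ContinuousLinearMap.mul ℝ ℝ) hv
      (hφd.of_le (by exact_mod_cast le_top)) y
    suffices h : -(∫ x, φ x) • (EuclideanSpace.proj i : E d →L[ℝ] ℝ)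
        = (convolution v (fderiv ℝ φ)
          (ContinuousLinearMap.precompR (E d) (ContinuousLinearMap.mul ℝ ℝ)) volume y) by
      rw [h]; exact h1
    have hψt : IsTestFunction U fun z => φ (y - z) := by
      have hs : tsupport (fun z => φ (y - z)) ⊆ Metric.closedBall y (ε / 2) := by
        refine closure_minimal (fun z hz => ?_) Metric.isClosed_closedBall
        have : y - z ∈ Metric.closedBall (0 : E d) (ε / 2) := hφs ▸ subset_tsupport _ hz
        rwa [mem_closedBall_zero_iff, ← dist_eq_norm, dist_comm] at this
      exact ⟨hφd.comp (contDiff_const.sub contDiff_id),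
        (isCompact_closedBall y (ε / 2)).of_isClosed_subset (isClosed_tsupport _) hs,
        hs.trans (hy.trans hεU)⟩
    have hψd : ∀ z j, gradient (fun z => φ (y - z)) z j
        = -fderiv ℝ φ (y - z) (EuclideanSpace.single j 1) := by
      intro z j
      have h := (((hφd.differentiable (by simp)) (y - z)).hasFDerivAt.comp z
        ((hasFDerivAt_const y z).sub (hasFDerivAt_id z))).fderiv
      rw [gradient_apply]
      refine (congrArg (fun L : E d →L[ℝ] ℝ => L (EuclideanSpace.single j 1)) h).trans ?_
      simp
    have key : ∀ j, (∫ z, v z * fderiv ℝ φ (y - z) (EuclideanSpace.single j 1))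
        = -((∫ x, φ x) * e j) := by
      intro j
      have h2 := hw.2.2 _ hψt j
      have h3 : ∫ z in U, g z j * φ (y - z) = -e j * ∫ x, φ x := by
        have h5 : ∫ z in U, φ (y - z) = ∫ x, φ x := by
          rw [← integral_sub_left_eq_self φ volume y]
          refine setIntegral_eq_integral_of_forall_compl_eq_zero fun z hz => ?_
          exact image_eq_zero_of_notMem_tsupport (f := fun z => φ (y - z))
            (fun h => hz (hψt.2.2 h))
        rw [← h5, ← integral_const_mul]
        refine integral_congr_ae ?_
        filter_upwards [hg] with z hz
        rw [hz]; rfl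
      have h4 : ∫ z, v z * fderiv ℝ φ (y - z) (EuclideanSpace.single j 1)
          = -∫ z in U, χ z * gradient (fun z => φ (y - z)) z j := by
        rw [← integral_neg, ← integral_indicator hUo.measurableSet]
        congr 1; ext z
        simp only [hψd]
        by_cases hz : z ∈ K
        · simp [v, hz, hεU hz]
        · have : fderiv ℝ φ (y - z) = 0 := by
            refine image_eq_zero_of_notMem_tsupport fun h => hz (hy ?_)
            have := hφs ▸ tsupport_fderiv_subset ℝ h
            rwa [mem_closedBall_zero_iff, ← dist_eq_norm, dist_comm] at this
          by_cases hzU : z ∈ U <;> simp [hzU, this]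
      rw [h4, h2, h3]; ring
    refine ContinuousLinearMap.coe_injective
      ((EuclideanSpace.basisFun (Fin d) ℝ).toBasis.ext fun j => ?_)
    simp only [OrthonormalBasis.coe_toBasis, EuclideanSpace.basisFun_apply,
      ContinuousLinearMap.coe_coe]
    rw [convolution_precompR_apply _ hv (φ.hasCompactSupport.fderiv ℝ)
      (hφd.continuous_fderiv (by simp))]
    refine Eq.trans ?_ (key j).symm
    simp [he, eq_comm]
  have hball : ∀ x ∈ Set.range p, ∀ y ∈ Metric.ball x (ε / 2), Metric.closedBall y (ε / 2) ⊆ K := by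
    intro x hx y hy z hz
    refine Metric.mem_cthickening_of_dist_le z x ε _ hx ?_
    rw [Metric.mem_ball] at hy
    rw [Metric.mem_closedBall] at hz
    linarith [dist_triangle z y x]
  -- The mollified `χ + yᵢ`: its derivative vanishes near the path, so it takes equal values at both
  -- ends. Periodicity of `χ` instead makes these values differ by `∫ φ > 0`.
  set G : E d → ℝ := fun y => F y + (∫ x, φ x) * y i
  have hG : ∀ x ∈ Set.range p, ∀ y ∈ Metric.ball x (ε / 2), G y = G x := by
    intro x hx y hy
    have hG' : ∀ y ∈ Metric.ball x (ε / 2), HasFDerivAt G (0 : E d →L[ℝ] ℝ) y := by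
      intro y hy
      have := (hder y (hball x hx y hy)).add
        (((EuclideanSpace.proj i : E d →L[ℝ] ℝ).hasFDerivAt (x := y)).const_mul (∫ x, φ x))
      exact this.congr_fderiv (by simp)
    refine (convex_ball x (ε / 2)).is_const_of_fderivWithin_eq_zero (𝕜 := ℝ)
      (fun y hy => (hG' y hy).differentiableAt.differentiableWithinAt) (fun y hy => ?_) hy
      (Metric.mem_ball_self (by positivity))
    rw [fderivWithin_of_isOpen Metric.isOpen_ball hy, (hG' y hy).fderiv]
  have hloc : IsLocallyConstant fun t => G (p t) := by
    rw [IsLocallyConstant.iff_eventually_eq]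
    intro t
    filter_upwards [p.continuous.continuousAt.preimage_mem_nhds
      (Metric.ball_mem_nhds (p t) (half_pos hε))] with s hs
    exact hG _ ⟨t, rfl⟩ _ hs
  have hGe : G (y₀ + e) = G y₀ := by
    have := hloc.apply_eq_of_preconnectedSpace 1 0
    simpa using this
  have hFe : F (y₀ + e) = F y₀ := by
    have hF' : ∀ x ∈ Set.range p, F x = ∫ z, χ z * φ (x - z) := by
      intro x hx
      refine integral_congr_ae (Eventually.of_forall fun z => ?_)
      by_cases hz : z ∈ K
      · simp [v, hz]
      · have : φ (x - z) = 0 := by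
          refine image_eq_zero_of_notMem_tsupport fun h => hz ?_
          rw [hφs, mem_closedBall_zero_iff, ← dist_eq_norm, dist_comm] at h
          exact hball x hx x (Metric.mem_ball_self (by positivity)) h
        simp [this]
    rw [hF' _ ⟨1, p.target⟩, hF' _ ⟨0, p.source⟩,
      ← integral_add_right_eq_self (fun z => χ z * φ (y₀ + e - z)) e]
    refine integral_congr_ae (Eventually.of_forall fun z => ?_)
    have := hper z (Pi.single i 1)
    rw [latticeVec_single] at this
    simp only [he, this, add_sub_add_right_eq_sub]
  simp only [G, PiLp.add_apply, he, PiLp.single_apply, if_true] at hGe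
  linarith

/-! ### The homogenized matrix -/

lemma memLp_coord {d : ℕ} {μ : Measure (E d)} {p : ℝ≥0∞} {g : E d → E d}
    (hg : MemLp g p μ) (i : Fin d) : MemLp (fun x => g x i) p μ :=
  (EuclideanSpace.proj (𝕜 := ℝ) i : E d →L[ℝ] ℝ).comp_memLp' hg

lemma IsDiffusion.integrable_mul {d : ℕ} {A : E d → Matrix (Fin d) (Fin d) ℝ}
    (hA : IsDiffusion A) {μ : Measure (E d)} (hμ : μ ≪ volume) {p q : E d → ℝ}
    (hp : MemLp p 2 μ) (hq : MemLp q 2 μ) (i j : Fin d) :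
    Integrable (fun y => A y i j * p y * q y) μ := by
  obtain ⟨B, hB⟩ := hA.bounded
  obtain ⟨K, hK⟩ := hA.lipschitz i j
  have h : Integrable (fun y => p y * q y) μ := hp.integrable_mul hq
  have := h.bdd_mul (f := fun y => A y i j) hK.continuous.aestronglyMeasurable
    (hμ.ae_le (hB i j))
  simpa [mul_assoc] using this

/-- The flux gradients `∇χᵢ + eᵢ`. -/
noncomputable def correctorGrad {d : ℕ} (g : Fin d → E d → E d) (i : Fin d) (y : E d) : E d :=
  g i y + EuclideanSpace.single i 1

lemma correctorGrad_apply {d : ℕ} (g : Fin d → E d → E d) (i k : Fin d) (y : E d) :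
    correctorGrad g i y k = g i y k + (if k = i then 1 else 0) := by
  simp [correctorGrad]

/-- Testing the `j`-th cell problem with `χᵢ` shows that the flux of `∇χⱼ + eⱼ` is orthogonal to
`∇χᵢ`, so pairing it with `eᵢ` or with `∇χᵢ + eᵢ` gives the same integral. -/
lemma homogenized_eq_gram {d : ℕ} {Ys : Set (E d)}
    {A : E d → Matrix (Fin d) (Fin d) ℝ} (hA : IsDiffusion A)
    {χ : Fin d → E d → ℝ} {g : Fin d → E d → E d}
    (hχ : ∀ i, IsCellSolution A Ys i (χ i) (g i)) (i j : Fin d) :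
    homogenized A Ys g i j = ∫ y in fluidCell Ys,
      ∑ k, ∑ l, A y k l * correctorGrad g j y l * correctorGrad g i y k := by
  have : IsFiniteMeasure (volume.restrict (fluidCell Ys)) :=
    ⟨by simpa using volume_fluidCell_lt_top Ys⟩
  have hc : ∀ i, MemLp (correctorGrad g i) 2 (volume.restrict (fluidCell Ys)) := fun i =>
    (hχ i).1.memLp_grad.add (memLp_const _)
  have hac : volume.restrict (fluidCell Ys) ≪ volume := Measure.absolutelyContinuous_restrict
  have h := (hχ j).2 (χ i) (g i) (hχ i).1
  simp only [← correctorGrad_apply] at h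
  have e : ∀ y, (∑ k, ∑ l, A y k l * correctorGrad g j y l * correctorGrad g i y k)
      = (∑ k, ∑ l, A y k l * correctorGrad g j y l * g i y k)
        + ∑ k, A y i k * correctorGrad g j y k := by
    intro y
    have e1 : ∀ k, (∑ l, A y k l * correctorGrad g j y l * correctorGrad g i y k)
        = (∑ l, A y k l * correctorGrad g j y l * g i y k)
          + if k = i then (∑ l, A y k l * correctorGrad g j y l) else 0 := by
      intro k
      split_ifs with hk <;>
      · rw [correctorGrad_apply g i k]
        simp [hk, mul_add, Finset.sum_add_distrib]
    simp only [e1, Finset.sum_add_distrib, Finset.sum_ite_eq', Finset.mem_univ, if_true]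
  simp only [e]
  rw [integral_add, h, zero_add]
  · simp only [homogenized, ← correctorGrad_apply]
  · exact integrable_finsetSum _ fun k _ => integrable_finsetSum _ fun l _ =>
      hA.integrable_mul hac (memLp_coord (hc j) l) (memLp_coord (hχ i).1.memLp_grad k) k l
  · refine integrable_finsetSum _ fun k _ => ?_
    simpa using hA.integrable_mul hac (memLp_coord (hc j) k) (memLp_const (1 : ℝ)) i k

lemma sum_gram_form {ι : Type*} [Fintype ι] (A c : ι → ι → ℝ) (ξ : ι → ℝ) :
    ∑ i, ∑ j, (∑ k, ∑ l, A k l * c j l * c i k) * ξ j * ξ i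
      = ∑ k, ∑ l, A k l * (∑ j, ξ j * c j k) * (∑ j, ξ j * c j l) := by
  have h : ∀ k l, A k l * (∑ j, ξ j * c j k) * (∑ j, ξ j * c j l)
      = ∑ i, ∑ j, A k l * c j l * c i k * ξ j * ξ i := by
    intro k l
    rw [mul_assoc, Finset.sum_mul_sum, Finset.mul_sum]
    refine Finset.sum_congr rfl fun i _ => ?_
    rw [Finset.mul_sum]
    exact Finset.sum_congr rfl fun j _ => by ring
  simp only [h, Finset.sum_mul]
  calc _ = ∑ i, ∑ k, ∑ j, ∑ l, A k l * c j l * c i k * ξ j * ξ i :=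
        Finset.sum_congr rfl fun i _ => Finset.sum_comm
    _ = ∑ k, ∑ i, ∑ j, ∑ l, A k l * c j l * c i k * ξ j * ξ i := Finset.sum_comm
    _ = ∑ k, ∑ i, ∑ l, ∑ j, A k l * c j l * c i k * ξ j * ξ i :=
        Finset.sum_congr rfl fun k _ => Finset.sum_congr rfl fun i _ => Finset.sum_comm
    _ = _ := Finset.sum_congr rfl fun k _ => Finset.sum_comm

/-- The quadratic form at `ξ` is the energy of the combined field `∑ ξⱼ (∇χⱼ + eⱼ)`, nonnegative
pointwise by ellipticity. -/
lemma homogenized_nonneg {d : ℕ} {Ys : Set (E d)}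
    {A : E d → Matrix (Fin d) (Fin d) ℝ} (hA : IsDiffusion A)
    {χ : Fin d → E d → ℝ} {g : Fin d → E d → E d}
    (hχ : ∀ i, IsCellSolution A Ys i (χ i) (g i)) (ξ : E d) :
    0 ≤ ∑ i, ∑ j, homogenized A Ys g i j * ξ j * ξ i := by
  have : IsFiniteMeasure (volume.restrict (fluidCell Ys)) :=
    ⟨by simpa using volume_fluidCell_lt_top Ys⟩
  have hc : ∀ i, MemLp (correctorGrad g i) 2 (volume.restrict (fluidCell Ys)) := fun i =>
    (hχ i).1.memLp_grad.add (memLp_const _)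
  have hac : volume.restrict (fluidCell Ys) ≪ volume := Measure.absolutelyContinuous_restrict
  have hint : ∀ i j, Integrable (fun y => ∑ k, ∑ l, A y k l * correctorGrad g j y l *
      correctorGrad g i y k) (volume.restrict (fluidCell Ys)) := fun i j =>
    integrable_finsetSum _ fun k _ => integrable_finsetSum _ fun l _ =>
      hA.integrable_mul hac (memLp_coord (hc j) l) (memLp_coord (hc i) k) k l
  have h : ∑ i, ∑ j, homogenized A Ys g i j * ξ j * ξ i = ∫ y in fluidCell Ys,
      ∑ k, ∑ l, A y k l * (∑ j, ξ j • correctorGrad g j y) k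
        * (∑ j, ξ j • correctorGrad g j y) l := by
    simp only [homogenized_eq_gram hA hχ, ← integral_mul_const]
    simp_rw [← integral_finsetSum _ (fun j _ => ((hint _ j).mul_const (ξ j)).mul_const _)]
    rw [← integral_finsetSum]
    · congr 1; ext y
      rw [sum_gram_form (A y) (fun i k => correctorGrad g i y k) ξ]
      simp
    · exact fun i _ => integrable_finsetSum _ fun j _ => ((hint i j).mul_const _).mul_const _
  rw [h]
  obtain ⟨lo, hlo, hi, -, hell⟩ := hA.elliptic
  exact integral_nonneg fun y => (by positivity : (0 : ℝ) ≤ lo * _).trans (hell y _).1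

/-- If the energy of `∇χᵢ + eᵢ` vanished, ellipticity would force `∇χᵢ = -eᵢ` almost everywhere in
the cell, and by periodicity in the whole fluid region. -/
lemma homogenized_diag_pos {d : ℕ} {Ys : Set (E d)} (hYs : IsAdmissibleCell Ys)
    {A : E d → Matrix (Fin d) (Fin d) ℝ} (hA : IsDiffusion A)
    {χ : Fin d → E d → ℝ} {g : Fin d → E d → E d}
    (hχ : ∀ i, IsCellSolution A Ys i (χ i) (g i)) (i : Fin d) :
    0 < homogenized A Ys g i i := by
  have : IsFiniteMeasure (volume.restrict (fluidCell Ys)) :=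
    ⟨by simpa using volume_fluidCell_lt_top Ys⟩
  have hc : MemLp (correctorGrad g i) 2 (volume.restrict (fluidCell Ys)) :=
    (hχ i).1.memLp_grad.add (memLp_const _)
  have hac : volume.restrict (fluidCell Ys) ≪ volume := Measure.absolutelyContinuous_restrict
  obtain ⟨lo, hlo, hi, -, hell⟩ := hA.elliptic
  have hell' : ∀ y, lo * ‖correctorGrad g i y‖ ^ 2
      ≤ ∑ k, ∑ l, A y k l * correctorGrad g i y l * correctorGrad g i y k := by
    intro y
    refine (hell y _).1.trans_eq (Finset.sum_congr rfl fun k _ => Finset.sum_congr rfl fun l _ => ?_)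
    ring
  have hnn : ∀ y, 0 ≤ ∑ k, ∑ l, A y k l * correctorGrad g i y l * correctorGrad g i y k :=
    fun y => (by positivity : (0 : ℝ) ≤ lo * _).trans (hell' y)
  rw [homogenized_eq_gram hA hχ]
  refine (integral_nonneg hnn).lt_of_ne' fun h0 => ?_
  rw [integral_eq_zero_iff_of_nonneg hnn (integrable_finsetSum _ fun k _ =>
    integrable_finsetSum _ fun l _ =>
      hA.integrable_mul hac (memLp_coord hc l) (memLp_coord hc k) k l)] at h0
  refine not_ae_weakGradient_eq_neg_single hYs (hχ i).1.periodic (hχ i).1.weakGradient i ?_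
  have h1 : ∀ᵐ y ∂volume.restrict (fluidCell Ys), g i y = -EuclideanSpace.single i (1 : ℝ) := by
    filter_upwards [h0] with y hy
    have h2 : lo * ‖correctorGrad g i y‖ ^ 2 ≤ 0 := (hell' y).trans_eq hy
    have h3 : ‖correctorGrad g i y‖ = 0 := by
      have : ‖correctorGrad g i y‖ ^ 2 ≤ 0 := by
        by_contra h; push Not at h; nlinarith
      exact pow_eq_zero_iff (two_ne_zero) |>.1 (le_antisymm this (by positivity))
    exact eq_neg_of_add_eq_zero_left (norm_eq_zero.1 h3)
  rw [ae_restrict_iff'₀ (measurableSet_fluidCell hYs).nullMeasurableSet, ae_iff] at h1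
  rw [ae_restrict_iff'₀ (isOpen_periodicFluid hYs).measurableSet.nullMeasurableSet, ae_iff]
  have := volume_periodicFluid_inter_eq_zero (Ys := Ys)
    (P := {y | g i y ≠ -EuclideanSpace.single i (1 : ℝ)})
    (fun y hy k => by
      change g i (y + latticeVec k) ≠ _
      rw [(hχ i).1.periodic_grad]; exact hy)
    (by convert h1 using 2; ext y; simp)
  convert this using 2; ext y; simp

/-! ### Weak solutions with constant coefficients and the maximum principle -/

/-- The bilinear form `(x, y) ↦ B x · y`. -/
def matForm {d : ℕ} (B : Matrix (Fin d) (Fin d) ℝ) (x y : E d) : ℝ :=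
  ∑ i, ∑ j, B i j * x j * y i

lemma matForm_sub_left {d : ℕ} (B : Matrix (Fin d) (Fin d) ℝ) (x x' y : E d) :
    matForm B (x - x') y = matForm B x y - matForm B x' y := by
  simp only [matForm, ← Finset.sum_sub_distrib]
  refine Finset.sum_congr rfl fun i _ => Finset.sum_congr rfl fun j _ => ?_
  simp; ring

lemma matForm_smul_right {d : ℕ} (B : Matrix (Fin d) (Fin d) ℝ) (c : ℝ) (x y : E d) :
    matForm B x (c • y) = c * matForm B x y := by
  simp only [matForm, Finset.mul_sum]
  refine Finset.sum_congr rfl fun i _ => Finset.sum_congr rfl fun j _ => ?_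
  simp; ring

lemma abs_matForm_le {d : ℕ} (B : Matrix (Fin d) (Fin d) ℝ) (x y : E d) :
    |matForm B x y| ≤ (∑ i, ∑ j, |B i j|) * (‖x‖ * ‖y‖) := by
  simp only [matForm, Finset.sum_mul]
  refine (Finset.abs_sum_le_sum_abs _ _).trans (Finset.sum_le_sum fun i _ => ?_)
  refine (Finset.abs_sum_le_sum_abs _ _).trans (Finset.sum_le_sum fun j _ => ?_)
  rw [abs_mul, abs_mul, mul_assoc]
  gcongr
  · exact PiLp.norm_apply_le x j
  · exact PiLp.norm_apply_le y i

lemma integrable_matForm {d : ℕ} (B : Matrix (Fin d) (Fin d) ℝ) {μ : Measure (E d)}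
    {g h : E d → E d} (hg : MemLp g 2 μ) (hh : MemLp h 2 μ) :
    Integrable (fun x => matForm B (g x) (h x)) μ := by
  refine integrable_finsetSum _ fun i _ => integrable_finsetSum _ fun j _ => ?_
  simp only [mul_assoc]
  exact ((memLp_coord hg j).integrable_mul (memLp_coord hh i)).const_mul _

/-- Cauchy–Schwarz, obtained from Hölder's inequality for the scalar product of the two norms. -/
lemma integral_norm_mul_norm_le {α F G : Type*} [MeasurableSpace α] {μ : Measure α}
    [NormedAddCommGroup F] [NormedAddCommGroup G] {f : α → F} {g : α → G}
    (hf : MemLp f 2 μ) (hg : MemLp g 2 μ) :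
    ∫ x, ‖f x‖ * ‖g x‖ ∂μ ≤ (eLpNorm f 2 μ).toReal * (eLpNorm g 2 μ).toReal := by
  have h := eLpNorm_smul_le_mul_eLpNorm (p := 2) (q := 2) (r := 1) hg.norm.1 hf.norm.1
  rw [eLpNorm_norm, eLpNorm_norm] at h
  have h2 : ∫ x, ‖f x‖ * ‖g x‖ ∂μ
      = (eLpNorm ((fun x => ‖f x‖) • fun x => ‖g x‖) 1 μ).toReal := by
    rw [eLpNorm_one_eq_lintegral_enorm, ← integral_norm_eq_lintegral_enorm]
    · refine integral_congr_ae (Eventually.of_forall fun x => ?_)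
      simp
    · exact hf.norm.1.smul hg.norm.1
  rw [h2, ← ENNReal.toReal_mul]
  exact ENNReal.toReal_mono (ENNReal.mul_ne_top hf.2.ne hg.2.ne) h

lemma tendsto_integral_norm_mul_norm {α F G : Type*} [MeasurableSpace α] {μ : Measure α}
    [NormedAddCommGroup F] [NormedAddCommGroup G] {f : α → F} {g : ℕ → α → G}
    (hf : MemLp f 2 μ) (hg : ∀ n, MemLp (g n) 2 μ)
    (h0 : Tendsto (fun n => eLpNorm (g n) 2 μ) atTop (𝓝 0)) :
    Tendsto (fun n => ∫ x, ‖f x‖ * ‖g n x‖ ∂μ) atTop (𝓝 0) := by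
  have h1 := (ENNReal.tendsto_toReal ENNReal.zero_ne_top).comp h0
  have h2 := h1.const_mul (eLpNorm f 2 μ).toReal
  rw [ENNReal.toReal_zero, mul_zero] at h2
  exact squeeze_zero (fun n => by positivity) (fun n => integral_norm_mul_norm_le hf (hg n)) h2

lemma tendsto_integral_norm_sq {α G : Type*} [MeasurableSpace α] {μ : Measure α}
    [NormedAddCommGroup G] {g : ℕ → α → G} (hg : ∀ n, MemLp (g n) 2 μ)
    (h0 : Tendsto (fun n => eLpNorm (g n) 2 μ) atTop (𝓝 0)) :
    Tendsto (fun n => ∫ x, ‖g n x‖ * ‖g n x‖ ∂μ) atTop (𝓝 0) := by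
  have h1 := (ENNReal.tendsto_toReal ENNReal.zero_ne_top).comp h0
  have h2 := h1.mul h1
  rw [ENNReal.toReal_zero, mul_zero] at h2
  exact squeeze_zero (fun n => by positivity)
    (fun n => integral_norm_mul_norm_le (hg n) (hg n)) h2

lemma continuous_gradient {d : ℕ} {φ : E d → ℝ} (h : ContDiff ℝ ∞ φ) :
    Continuous (gradient φ) :=
  (LinearIsometryEquiv.continuous _).comp (h.continuous_fderiv (by simp))

lemma IsTestFunction.memLp {d : ℕ} {U : Set (E d)} {φ : E d → ℝ} (h : IsTestFunction U φ)
    (μ : Measure (E d)) [IsFiniteMeasureOnCompacts μ] : MemLp φ 2 μ :=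
  h.1.continuous.memLp_of_hasCompactSupport h.2.1

lemma IsTestFunction.hasCompactSupport_gradient {d : ℕ} {U : Set (E d)} {φ : E d → ℝ}
    (h : IsTestFunction U φ) : HasCompactSupport (gradient φ) :=
  (h.2.1.fderiv ℝ).comp_left (map_zero _)

lemma IsTestFunction.memLp_gradient {d : ℕ} {U : Set (E d)} {φ : E d → ℝ}
    (h : IsTestFunction U φ) (μ : Measure (E d)) [IsFiniteMeasureOnCompacts μ] :
    MemLp (gradient φ) 2 μ :=
  (continuous_gradient h.1).memLp_of_hasCompactSupport h.hasCompactSupport_gradient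

lemma IsTestFunction.memH10 {d : ℕ} {U : Set (E d)} {φ : E d → ℝ} (h : IsTestFunction U φ) :
    MemH10 U φ (gradient φ) :=
  ⟨h.memLp _, h.memLp_gradient _, fun _ => φ, fun _ => h, by simp, by simp⟩

lemma isFiniteMeasure_restrict_of_isBounded {d : ℕ} {Ω : Set (E d)}
    (hb : Bornology.IsBounded Ω) : IsFiniteMeasure (volume.restrict Ω) :=
  ⟨by simpa using hb.measure_lt_top⟩

lemma memLp_restrict_of_continuousOn {d : ℕ} {F : Type*} [NormedAddCommGroup F]
    {Ω : Set (E d)} (ho : IsOpen Ω)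
    (hb : Bornology.IsBounded Ω) {h : E d → F} (hc : ContinuousOn h (closure Ω)) :
    MemLp h 2 (volume.restrict Ω) := by
  have := isFiniteMeasure_restrict_of_isBounded hb
  obtain ⟨C, hC⟩ := hb.isCompact_closure.exists_bound_of_continuousOn hc
  exact MemLp.of_bound ((hc.mono subset_closure).aestronglyMeasurable ho.measurableSet) C
    (ae_restrict_of_forall_mem ho.measurableSet fun x hx => hC x (subset_closure hx))

/-- The transition is constant outside `[0, 1]`, so its continuous derivative has compact support.
-/
lemma exists_abs_deriv_smoothTransition_le :
    ∃ L : ℝ≥0, ∀ t, |deriv Real.smoothTransition t| ≤ L := by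
  have hs : HasCompactSupport (deriv Real.smoothTransition) := by
    refine HasCompactSupport.intro (isCompact_Icc (a := (0 : ℝ)) (b := 1)) fun t ht => ?_
    rcases lt_or_ge t 0 with h | h
    · have : Real.smoothTransition =ᶠ[𝓝 t] fun _ => 0 := by
        filter_upwards [Iio_mem_nhds h] with s hs
        exact Real.smoothTransition.zero_of_nonpos (le_of_lt hs)
      rw [this.deriv_eq, deriv_const]
    · have h1 : 1 < t := by
        by_contra h'; exact ht ⟨h, not_lt.1 h'⟩
      have : Real.smoothTransition =ᶠ[𝓝 t] fun _ => 1 := by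
        filter_upwards [Ioi_mem_nhds h1] with s hs
        exact Real.smoothTransition.one_of_one_le (le_of_lt hs)
      rw [this.deriv_eq, deriv_const]
  obtain ⟨C, hC⟩ := hs.exists_bound_of_continuous
    ((Real.smoothTransition.contDiff (n := 1)).continuous_deriv le_rfl)
  exact ⟨C.toNNReal, fun t => (hC t).trans (Real.le_coe_toNNReal C)⟩

/-- `u ∈ H¹₀(Ω)`, with gradient `g`, solves `-∇·(B∇u) + κ u = F` weakly. -/
def IsWeakSolution {d : ℕ} (Ω : Set (E d)) (B : Matrix (Fin d) (Fin d) ℝ) (κ : ℝ)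
    (F u : E d → ℝ) (g : E d → E d) : Prop :=
  MemH10 Ω u g ∧ MemLp F 2 (volume.restrict Ω) ∧ ∀ φ, IsTestFunction Ω φ →
    (∫ x in Ω, matForm B (g x) (gradient φ x)) + κ * ∫ x in Ω, u x * φ x
      = ∫ x in Ω, F x * φ x

lemma MemH10.sub {d : ℕ} {Ω : Set (E d)} {u v : E d → ℝ} {g h : E d → E d}
    (hu : MemH10 Ω u g) (hv : MemH10 Ω v h) : MemH10 Ω (u - v) (g - h) := by
  obtain ⟨hu1, hu2, φ, hφ, hφ1, hφ2⟩ := hu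
  obtain ⟨hv1, hv2, ψ, hψ, hψ1, hψ2⟩ := hv
  have hgr : ∀ n x, gradient (φ n - ψ n) x = gradient (φ n) x - gradient (ψ n) x := by
    intro n x
    simp only [gradient]
    rw [fderiv_sub ((hφ n).1.differentiable (by simp) x) ((hψ n).1.differentiable (by simp) x),
      map_sub]
  refine ⟨hu1.sub hv1, hu2.sub hv2, fun n => φ n - ψ n, fun n => ⟨(hφ n).1.sub (hψ n).1,
    (hφ n).2.1.sub (hψ n).2.1, (tsupport_sub _ _).trans (Set.union_subset (hφ n).2.2 (hψ n).2.2)⟩,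
    ?_, ?_⟩
  · refine tendsto_of_tendsto_of_tendsto_of_le_of_le tendsto_const_nhds
      (by simpa using hφ1.add hψ1) (fun _ => zero_le) fun n => ?_
    refine (le_of_eq ?_).trans (eLpNorm_sub_le (hu1.sub ((hφ n).memLp _)).1
      (hv1.sub ((hψ n).memLp _)).1 (by norm_num))
    congr 1; ext x; simp; ring
  · refine tendsto_of_tendsto_of_tendsto_of_le_of_le tendsto_const_nhds
      (by simpa using hφ2.add hψ2) (fun _ => zero_le) fun n => ?_
    refine (le_of_eq ?_).trans (eLpNorm_sub_le (hu2.sub ((hφ n).memLp_gradient _)).1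
      (hv2.sub ((hψ n).memLp_gradient _)).1 (by norm_num))
    congr 1; ext1 x; rw [hgr]; simp only [Pi.sub_apply]; abel

lemma IsWeakSolution.sub {d : ℕ} {Ω : Set (E d)} {B : Matrix (Fin d) (Fin d) ℝ} {κ : ℝ}
    {F F' u u' : E d → ℝ} {g g' : E d → E d} (h : IsWeakSolution Ω B κ F u g)
    (h' : IsWeakSolution Ω B κ F' u' g') :
    IsWeakSolution Ω B κ (F - F') (u - u') (g - g') := by
  refine ⟨h.1.sub h'.1, h.2.1.sub h'.2.1, fun φ hφ => ?_⟩
  have i1 := integral_sub (integrable_matForm B h.1.2.1 (hφ.memLp_gradient _))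
    (integrable_matForm B h'.1.2.1 (hφ.memLp_gradient _))
  have i2 := integral_sub (h.1.1.integrable_mul (hφ.memLp _)) (h'.1.1.integrable_mul (hφ.memLp _))
  have i3 := integral_sub (h.2.1.integrable_mul (hφ.memLp _)) (h'.2.1.integrable_mul (hφ.memLp _))
  simp only [Pi.mul_apply] at i2 i3
  simp only [Pi.sub_apply, matForm_sub_left, sub_mul]
  rw [i1, i2, i3, mul_sub, ← h.2.2 φ hφ, ← h'.2.2 φ hφ]
  ring

lemma isWeakSolution_zero {d : ℕ} (Ω : Set (E d)) (B : Matrix (Fin d) (Fin d) ℝ) (κ : ℝ) :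
    IsWeakSolution Ω B κ 0 0 0 := by
  have h0 : IsTestFunction Ω (0 : E d → ℝ) :=
    ⟨contDiff_const, HasCompactSupport.zero, by simp [tsupport]⟩
  have hg : gradient (0 : E d → ℝ) = 0 := by
    ext x i; rw [gradient_apply]; simp
  refine ⟨hg ▸ h0.memH10, MemLp.zero, fun φ _ => by simp [matForm]⟩

lemma IsWeakSolution.neg {d : ℕ} {Ω : Set (E d)} {B : Matrix (Fin d) (Fin d) ℝ} {κ : ℝ}
    {F u : E d → ℝ} {g : E d → E d} (h : IsWeakSolution Ω B κ F u g) :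
    IsWeakSolution Ω B κ (-F) (-u) (-g) := by
  simpa using (isWeakSolution_zero Ω B κ).sub h

/-- A smooth bounded substitute for the positive part `(φ - b)⁺`. Where `φ = 0` the argument is at
most 0 because `b ≥ 0`, so the support does not grow. -/
lemma isTestFunction_smoothTransition_comp {d : ℕ} {Ω : Set (E d)} {φ b : E d → ℝ}
    (hφ : IsTestFunction Ω φ) (hb : ContDiff ℝ ∞ b) (hb0 : ∀ x, 0 ≤ b x) :
    IsTestFunction Ω fun x => Real.smoothTransition (φ x - b x) := by
  have hs : tsupport (fun x => Real.smoothTransition (φ x - b x)) ⊆ tsupport φ := by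
    refine closure_mono fun x hx h => hx ?_
    exact Real.smoothTransition.zero_of_nonpos (by rw [h]; simpa using hb0 x)
  exact ⟨Real.smoothTransition.contDiff.comp (hφ.1.sub hb),
    hφ.2.1.of_isClosed_subset (isClosed_tsupport _) hs, hs.trans hφ.2.2⟩

lemma gradient_smoothTransition_comp {d : ℕ} {φ b : E d → ℝ}
    (hφ : ContDiff ℝ ∞ φ) (hb : ContDiff ℝ ∞ b) (x : E d) :
    gradient (fun x => Real.smoothTransition (φ x - b x)) x
      = deriv Real.smoothTransition (φ x - b x) • (gradient φ x - gradient b x) := by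
  have hd := ((Real.smoothTransition.contDiff (n := 1)).differentiable (by simp) (φ x - b x)).hasDerivAt
  have h := hd.comp_hasFDerivAt x ((hφ.differentiable (by simp) x).hasFDerivAt.sub
    (hb.differentiable (by simp) x).hasFDerivAt)
  ext i
  rw [gradient_apply]
  refine (congrArg (fun L : E d →L[ℝ] ℝ => L (EuclideanSpace.single i 1)) h.fderiv).trans ?_
  simp [gradient_apply]

/-- Weak comparison with a smooth nonnegative supersolution. -/
theorem IsWeakSolution.le_supersolution {d : ℕ} {Ω : Set (E d)} (hΩo : IsOpen Ω)
    (hΩb : Bornology.IsBounded Ω) {B : Matrix (Fin d) (Fin d) ℝ} (hB : ∀ ξ, 0 ≤ matForm B ξ ξ)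
    {κ : ℝ} (hκ : 0 < κ) {F w : E d → ℝ} {g : E d → E d} (hw : IsWeakSolution Ω B κ F w g)
    {b c : E d → ℝ} (hb : ContDiff ℝ ∞ b) (hb0 : ∀ x, 0 ≤ b x) (hc : Continuous c)
    (hbc : ∀ φ, IsTestFunction Ω φ →
      ∫ x in Ω, matForm B (gradient b x) (gradient φ x) = ∫ x in Ω, c x * φ x)
    (hsup : ∀ᵐ x ∂volume.restrict Ω, F x ≤ c x + κ * b x) :
    ∀ᵐ x ∂volume.restrict Ω, w x ≤ b x := by
  obtain ⟨⟨hw2, hg2, φ, hφ, hφw, hφg⟩, hF2, hweak⟩ := hw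
  obtain ⟨L, hL⟩ := exists_abs_deriv_smoothTransition_le
  have hLip : LipschitzWith L Real.smoothTransition :=
    lipschitzWith_of_nnnorm_deriv_le
      ((Real.smoothTransition.contDiff (n := 1)).differentiable (by simp)) fun t => hL t
  set μ := volume.restrict Ω
  have hfin : IsFiniteMeasure μ := isFiniteMeasure_restrict_of_isBounded hΩb
  set S := ∑ i, ∑ j, |B i j|
  have hS : 0 ≤ S := by positivity
  have hb2 : MemLp b 2 μ := memLp_restrict_of_continuousOn hΩo hΩb hb.continuous.continuousOn
  have hgb2 : MemLp (gradient b) 2 μ :=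
    memLp_restrict_of_continuousOn hΩo hΩb (continuous_gradient hb).continuousOn
  have hc2 : MemLp c 2 μ := memLp_restrict_of_continuousOn hΩo hΩb hc.continuousOn
  -- The smooth approximants `φ n` of `w` are truncated rather than `w` itself, so only the
  -- classical chain rule is needed; the limit is taken in the tested identity.
  set ψ : ℕ → E d → ℝ := fun n x => Real.smoothTransition (φ n x - b x)
  have hψ : ∀ n, IsTestFunction Ω (ψ n) := fun n =>
    isTestFunction_smoothTransition_comp (hφ n) hb hb0
  have hψg : ∀ n x, gradient (ψ n) x
      = deriv Real.smoothTransition (φ n x - b x) • (gradient (φ n) x - gradient b x) := fun n x =>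
    gradient_smoothTransition_comp (hφ n).1 hb x
  set e : ℕ → E d → E d := fun n x => g x - gradient (φ n) x
  have he2 : ∀ n, MemLp (e n) 2 μ := fun n => hg2.sub ((hφ n).memLp_gradient _)
  set G : E d → E d := fun x => g x - gradient b x
  have hG2 : MemLp G 2 μ := hg2.sub hgb2
  -- The equations for `w` and `b` subtract to `∫ B G·∇ψ = ∫ H ψ` for every test function `ψ`.
  set H : E d → ℝ := fun x => F x - κ * w x - c x
  have hH2 : MemLp H 2 μ := (hF2.sub (hw2.const_mul κ)).sub hc2
  set θ : E d → ℝ := fun x => Real.smoothTransition (w x - b x)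
  have hθ2 : MemLp θ 2 μ := by
    refine MemLp.of_bound (C := 1) (Real.smoothTransition.continuous.comp_aestronglyMeasurable
      (hw2.sub hb2).1) (Eventually.of_forall fun x => ?_)
    rw [Real.norm_of_nonneg (Real.smoothTransition.nonneg _)]
    exact Real.smoothTransition.le_one _
  -- energy inequality for the approximate test functions
  have hen : ∀ n, -(S * L) * ((∫ x, ‖e n x‖ * ‖e n x‖ ∂μ) + ∫ x, ‖G x‖ * ‖e n x‖ ∂μ)
      ≤ ∫ x, H x * ψ n x ∂μ := by
    intro n
    have hψ2 : MemLp (ψ n) 2 μ := (hψ n).memLp _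
    have hψg2 : MemLp (gradient (ψ n)) 2 μ := (hψ n).memLp_gradient _
    have h1 : ∫ x, H x * ψ n x ∂μ = ∫ x, matForm B (G x) (gradient (ψ n) x) ∂μ := by
      simp only [H, G, sub_mul, matForm_sub_left]
      rw [integral_sub, integral_sub, integral_sub, ← hweak _ (hψ n), ← hbc _ (hψ n)]
      · simp only [mul_assoc, integral_const_mul]; ring
      · exact integrable_matForm B hg2 hψg2
      · exact integrable_matForm B hgb2 hψg2
      · exact hF2.integrable_mul hψ2
      · exact (hw2.const_mul κ).integrable_mul hψ2
      · exact (hF2.integrable_mul hψ2).sub ((hw2.const_mul κ).integrable_mul hψ2)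
      · exact hc2.integrable_mul hψ2
    have i1 : Integrable (fun x => ‖e n x‖ * ‖e n x‖) μ := (he2 n).norm.integrable_mul (he2 n).norm
    have i2 : Integrable (fun x => ‖G x‖ * ‖e n x‖) μ := hG2.norm.integrable_mul (he2 n).norm
    rw [h1, ← integral_add i1 i2, ← integral_const_mul]
    refine integral_mono ((i1.add i2).const_mul _) (integrable_matForm B hG2 hψg2) fun x => ?_
    set t := deriv Real.smoothTransition (φ n x - b x)
    have ht0 : 0 ≤ t := Real.smoothTransition.monotone.deriv_nonneg
    have htL : t ≤ L := (le_abs_self t).trans (hL _)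
    set q := gradient (φ n) x - gradient b x
    -- The substitution `G = q + e n` splits the form into `t B q·q ≥ 0` and an error linear in `e
    -- n`, which vanishes in the limit since `e n → 0` in `L²`.
    have hq : q = G x - e n x := by simp [q, G, e]
    have hqn : ‖q‖ ≤ ‖e n x‖ + ‖G x‖ := by
      rw [hq, add_comm]; exact norm_sub_le _ _
    have h2 : matForm B (G x) (gradient (ψ n) x) = t * matForm B (e n x) q + t * matForm B q q := by
      rw [hψg, matForm_smul_right]
      change t * matForm B (G x) q = _
      have h := matForm_sub_left B (G x) (e n x) q
      rw [← hq] at h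
      rw [h]
      ring
    have h3 : |t * matForm B (e n x) q| ≤ S * L * (‖e n x‖ * ‖e n x‖ + ‖G x‖ * ‖e n x‖) := by
      rw [abs_mul, abs_of_nonneg ht0]
      calc t * |matForm B (e n x) q| ≤ L * (S * (‖e n x‖ * ‖q‖)) := by
            gcongr; exact abs_matForm_le B _ _
        _ ≤ L * (S * (‖e n x‖ * (‖e n x‖ + ‖G x‖))) := by gcongr
        _ = _ := by ring
    have h4 := mul_nonneg ht0 (hB q)
    have h5 := neg_abs_le (t * matForm B (e n x) q)
    change -(S * L) * (‖e n x‖ * ‖e n x‖ + ‖G x‖ * ‖e n x‖) ≤ matForm B (G x) (gradient (ψ n) x)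
    rw [h2]
    linarith
  have hlim : Tendsto (fun n => ∫ x, H x * ψ n x ∂μ) atTop (𝓝 (∫ x, H x * θ x ∂μ)) := by
    have h0 := (tendsto_integral_norm_mul_norm hH2 (fun n => hw2.sub ((hφ n).memLp _)) hφw).const_mul
      (L : ℝ)
    rw [mul_zero] at h0
    rw [tendsto_iff_norm_sub_tendsto_zero]
    refine squeeze_zero (fun n => norm_nonneg _) (fun n => ?_) h0
    have i1 : Integrable (fun x => H x * ψ n x) μ := hH2.integrable_mul ((hψ n).memLp _)
    have i2 : Integrable (fun x => H x * θ x) μ := hH2.integrable_mul hθ2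
    rw [← integral_sub i1 i2, ← integral_const_mul]
    refine (norm_integral_le_integral_norm _).trans (integral_mono (i1.sub i2).norm
      ((hH2.norm.integrable_mul (hw2.sub ((hφ n).memLp _)).norm).const_mul _) fun x => ?_)
    have h1 := hLip.dist_le_mul (φ n x - b x) (w x - b x)
    rw [Real.dist_eq, dist_sub_right, dist_comm, Real.dist_eq] at h1
    change ‖H x * ψ n x - H x * θ x‖ ≤ L * (‖H x‖ * ‖w x - φ n x‖)
    rw [← mul_sub, norm_mul]
    calc ‖H x‖ * ‖ψ n x - θ x‖ ≤ ‖H x‖ * (L * ‖w x - φ n x‖) := by gcongr; exact h1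
      _ = _ := by ring
  have hlim2 := ((tendsto_integral_norm_sq he2 hφg).add
    (tendsto_integral_norm_mul_norm hG2 he2 hφg)).const_mul (-(S * L))
  rw [add_zero, mul_zero] at hlim2
  have hpos : 0 ≤ ∫ x, H x * θ x ∂μ := le_of_tendsto_of_tendsto' hlim2 hlim hen
  have hle : ∀ᵐ x ∂μ, H x * θ x ≤ κ * (b x - w x) * θ x := by
    filter_upwards [hsup] with x hx
    refine mul_le_mul_of_nonneg_right ?_ (Real.smoothTransition.nonneg _)
    simp only [H]; linarith
  have hsign : ∀ x, 0 ≤ κ * (w x - b x) * θ x := by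
    intro x
    rcases le_total (w x) (b x) with h | h
    · simp [θ, Real.smoothTransition.zero_of_nonpos (sub_nonpos.2 h)]
    · exact mul_nonneg (mul_nonneg hκ.le (sub_nonneg.2 h)) (Real.smoothTransition.nonneg _)
  have i3 : Integrable (fun x => κ * (w x - b x) * θ x) μ :=
    ((hw2.sub hb2).const_mul κ).integrable_mul hθ2
  -- The supersolution inequality gives `H ≤ κ (b - w)`, so `0 ≤ ∫ H θ` forces the nonnegative
  -- integrand `κ (w - b) θ` to have integral zero.
  have hz : ∫ x, κ * (w x - b x) * θ x ∂μ = 0 := by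
    refine le_antisymm ?_ (integral_nonneg hsign)
    have := integral_mono_ae (hH2.integrable_mul hθ2) i3.neg (by
      filter_upwards [hle] with x hx
      refine hx.trans_eq ?_
      simp only [Pi.neg_apply]; ring)
    simp only [Pi.neg_apply, Pi.mul_apply, integral_neg] at this
    linarith
  rw [integral_eq_zero_iff_of_nonneg hsign i3] at hz
  filter_upwards [hz] with x hx
  by_contra! h
  have : 0 < κ * (w x - b x) * θ x :=
    mul_pos (mul_pos hκ (sub_pos.2 h)) (Real.smoothTransition.pos_of_pos (sub_pos.2 h))
  exact this.ne' hx

/-! ### A barrier and the contraction in the maximum norm -/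

/-- A bounded one-dimensional supersolution of `-a p'' + κ p = κ` on `[-R, R]` that stays
below `1`. -/
lemma exists_barrier_profile {a κ R : ℝ} (ha : 0 < a) (hκ : 0 < κ) (hR : 0 < R) :
    ∃ (p p' p'' : ℝ → ℝ) (ρ : ℝ), 0 ≤ ρ ∧ ρ < 1 ∧ ContDiff ℝ ∞ p ∧ Continuous p'' ∧
      (∀ t, HasDerivAt p (p' t) t) ∧ (∀ t, HasDerivAt p' (p'' t) t) ∧ (∀ t, 0 ≤ p t) ∧
      ∀ t, |t| ≤ R → p t ≤ ρ ∧ κ ≤ κ * p t - a * p'' t := by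
  set T := κ * R ^ 2 / a
  have hT : 0 < T := by positivity
  -- Chosen so that `l (l/4 - 1) = l T ≥ T`, where `1/4` bounds `cos²` below on `|t / R| ≤ 1`.
  set l := 4 + 4 * T
  have hl : 0 < l := by positivity
  -- The sine keeps `h` between `exp (-l)` and `exp l` on all of `ℝ`. This makes `p = 1 - exp (-l)
  -- h` nonnegative everywhere, as the comparison lemma demands, and at most `ρ = 1 - exp (-2l) <
  -- 1`.
  set h : ℝ → ℝ := fun t => Real.exp (l * Real.sin (t / R))
  have hh : ∀ t, HasDerivAt h (l * (Real.cos (t / R) / R) * h t) t := by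
    intro t
    have := ((((hasDerivAt_id t).div_const R).sin).const_mul l).exp
    exact this.congr_deriv (by simp only [h, id]; ring)
  refine ⟨fun t => 1 - Real.exp (-l) * h t,
    fun t => -(Real.exp (-l) * (l * (Real.cos (t / R) / R) * h t)),
    fun t => -(Real.exp (-l) * ((l * (-Real.sin (t / R) / R / R)
      + (l * (Real.cos (t / R) / R)) ^ 2) * h t)), 1 - Real.exp (-l) * Real.exp (-l),
      ?_, ?_, ?_, ?_, ?_, ?_, ?_, ?_⟩
  · have : Real.exp (-l) ≤ 1 := Real.exp_le_one_iff.2 (by linarith)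
    nlinarith [Real.exp_pos (-l)]
  · have := Real.exp_pos (-l); nlinarith
  · fun_prop
  · fun_prop
  · intro t
    exact (((hh t).const_mul _).const_sub 1)
  · intro t
    have h1 : HasDerivAt (fun t => l * (Real.cos (t / R) / R)) (l * (-Real.sin (t / R) / R / R)) t := by
      have := ((((hasDerivAt_id t).div_const R).cos).div_const R).const_mul l
      exact this.congr_deriv (by simp only [id]; ring)
    exact (((h1.mul (hh t)).const_mul (Real.exp (-l))).neg).congr_deriv (by ring)
  · intro t
    simp only [h]
    rw [← Real.exp_add, sub_nonneg, Real.exp_le_one_iff]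
    nlinarith [Real.sin_le_one (t / R)]
  · intro t ht
    have hs : |t / R| ≤ 1 := by rw [abs_div, abs_of_pos hR]; exact (div_le_one hR).2 ht
    have hc : 1 / 2 ≤ Real.cos (t / R) := by
      have := Real.one_sub_sq_div_two_le_cos (x := t / R)
      nlinarith [sq_le_one_iff_abs_le_one (t / R) |>.2 hs]
    constructor
    · have : Real.exp (-l) ≤ h t :=
        Real.exp_le_exp.2 (by nlinarith [Real.neg_one_le_sin (t / R)])
      nlinarith [Real.exp_pos (-l)]
    · have hq : κ ≤ a * (l * (-Real.sin (t / R) / R / R) + (l * (Real.cos (t / R) / R)) ^ 2) := by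
        have h1 : l * (-Real.sin (t / R) / R / R) + (l * (Real.cos (t / R) / R)) ^ 2
            = (l * (l * Real.cos (t / R) ^ 2 - Real.sin (t / R))) / R ^ 2 := by
          field_simp; ring
        have h2 : T ≤ l * (l * Real.cos (t / R) ^ 2 - Real.sin (t / R)) := by
          have h3 : 1 / 4 ≤ Real.cos (t / R) ^ 2 := by nlinarith
          have h4 : T ≤ l * Real.cos (t / R) ^ 2 - Real.sin (t / R) := by
            have := Real.sin_le_one (t / R)
            have h5 : l * (1 / 4) ≤ l * Real.cos (t / R) ^ 2 := by gcongr
            simp only [l] at h5 ⊢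
            linarith
          have h6 : 1 ≤ l := by simp only [l]; linarith
          nlinarith
        rw [h1, ← mul_div_assoc, le_div_iff₀ (by positivity)]
        calc κ * R ^ 2 = a * T := by simp only [T]; field_simp
          _ ≤ _ := by gcongr
      have hpos : 0 < Real.exp (-l) * h t := mul_pos (Real.exp_pos _) (Real.exp_pos _)
      nlinarith [mul_le_mul_of_nonneg_left hq hpos.le]

lemma gradient_comp_coord {d : ℕ} {p p' : ℝ → ℝ} (hp : ∀ t, HasDerivAt p (p' t) t) (N : ℝ)
    (i : Fin d) (x : E d) :
    gradient (fun x : E d => N * p (x i)) x = (N * p' (x i)) • EuclideanSpace.single i (1 : ℝ) := by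
  have h := ((hp (x i)).comp_hasFDerivAt x
    (EuclideanSpace.proj i : E d →L[ℝ] ℝ).hasFDerivAt).const_mul N
  ext j
  rw [gradient_apply]
  refine (congrArg (fun L : E d →L[ℝ] ℝ => L (EuclideanSpace.single j 1)) h.fderiv).trans ?_
  simp [eq_comm]

lemma integral_comp_coord_mul_gradient {d : ℕ} {p p' : ℝ → ℝ}
    (hp : ∀ t, HasDerivAt p (p' t) t) (hp' : Continuous p') {Ω : Set (E d)} {φ : E d → ℝ}
    (hφ : IsTestFunction Ω φ) (i j : Fin d) :
    ∫ x in Ω, p (x i) * gradient φ x j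
      = -∫ x in Ω, (if j = i then p' (x i) else 0) * φ x := by
  have hpc : Continuous p := continuous_iff_continuousAt.2 fun t => (hp t).continuousAt
  have hci : Continuous fun x : E d => x i := (EuclideanSpace.proj (𝕜 := ℝ) i).continuous
  have hd : ∀ x : E d, HasFDerivAt (fun x : E d => p (x i))
      (p' (x i) • (EuclideanSpace.proj i : E d →L[ℝ] ℝ)) x := fun x =>
    (hp (x i)).comp_hasFDerivAt x (EuclideanSpace.proj i : E d →L[ℝ] ℝ).hasFDerivAt
  have hfd : ∀ x : E d, fderiv ℝ (fun x : E d => p (x i)) x (EuclideanSpace.single j 1)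
      = if j = i then p' (x i) else 0 := by
    intro x
    refine (congrArg (fun L : E d →L[ℝ] ℝ => L (EuclideanSpace.single j 1)) (hd x).fderiv).trans ?_
    simp [eq_comm]
  have hz : ∀ x, x ∉ Ω → x ∉ tsupport φ := fun x hx h => hx (hφ.2.2 h)
  rw [setIntegral_eq_integral_of_forall_compl_eq_zero, setIntegral_eq_integral_of_forall_compl_eq_zero]
  · simp only [gradient_apply, ← hfd]
    have hφc := hφ.1.continuous
    have hφ' := hφ.1.continuous_fderiv (by simp)
    refine integral_mul_fderiv_eq_neg_fderiv_mul_of_integrable ?_ ?_ ?_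
      (fun x _ => (hd x).differentiableAt) fun x _ => hφ.1.differentiable (by simp) x
    · refine Continuous.integrable_of_hasCompactSupport ?_ hφ.2.1.mul_left
      simp only [hfd]
      split_ifs <;> fun_prop
    · refine Continuous.integrable_of_hasCompactSupport (by fun_prop) (HasCompactSupport.mul_left ?_)
      exact (hφ.2.1.fderiv ℝ).comp_left (g := fun L : E d →L[ℝ] ℝ => L (EuclideanSpace.single j 1))
        rfl
    · exact Continuous.integrable_of_hasCompactSupport (by fun_prop) hφ.2.1.mul_left
  · intro x hx
    rw [image_eq_zero_of_notMem_tsupport (hz x hx), mul_zero]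
  · intro x hx
    have : fderiv ℝ φ x = 0 := image_eq_zero_of_notMem_tsupport
      fun h => hz x hx (tsupport_fderiv_subset ℝ h)
    rw [gradient_apply, this]; simp

/-- The solution operator of `-∇·(B∇w) + κ w = F` with Dirichlet condition contracts strictly in the
maximum norm (after normalization by `κ`). -/
theorem exists_contraction {d : ℕ} {Ω : Set (E d)} (hΩo : IsOpen Ω)
    (hΩb : Bornology.IsBounded Ω) {B : Matrix (Fin d) (Fin d) ℝ} (hB : ∀ ξ, 0 ≤ matForm B ξ ξ)
    (i : Fin d) (hi : 0 < B i i) {κ : ℝ} (hκ : 0 < κ) :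
    ∃ ρ : ℝ, 0 ≤ ρ ∧ ρ < 1 ∧ ∀ (F w : E d → ℝ) (g : E d → E d) (N : ℝ), 0 ≤ N →
      IsWeakSolution Ω B κ F w g → (∀ᵐ x ∂volume.restrict Ω, |F x| ≤ κ * N) →
      ∀ᵐ x ∂volume.restrict Ω, |w x| ≤ ρ * N := by
  obtain ⟨R, hR, hRΩ⟩ := hΩb.subset_closedBall_lt 0 0
  obtain ⟨p, p', p'', ρ, hρ0, hρ1, hp, hp''c, hpd, hpd', hp0, hpR⟩ :=
    exists_barrier_profile hi hκ hR
  refine ⟨ρ, hρ0, hρ1, ?_⟩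
  have hΩR : ∀ x ∈ Ω, |x i| ≤ R := fun x hx =>
    (PiLp.norm_apply_le x i).trans (mem_closedBall_zero_iff.1 (hRΩ hx))
  have hci : Continuous fun x : E d => x i := (EuclideanSpace.proj (𝕜 := ℝ) i).continuous
  have key : ∀ (F w : E d → ℝ) (g : E d → E d) (N : ℝ), 0 ≤ N →
      IsWeakSolution Ω B κ F w g → (∀ᵐ x ∂volume.restrict Ω, F x ≤ κ * N) →
      ∀ᵐ x ∂volume.restrict Ω, w x ≤ ρ * N := by
    intro F w g N hN hw hF
    -- The barrier depends on the coordinate `xᵢ` alone, so only `B i i` survives in its elliptic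
    -- operator and no further positivity of `B` is needed.
    have h := hw.le_supersolution hΩo hΩb hB hκ (b := fun x => N * p (x i))
      (c := fun x => -(B i i * N) * p'' (x i))
      (contDiff_const.mul (hp.comp (EuclideanSpace.proj (𝕜 := ℝ) i : E d →L[ℝ] ℝ).contDiff))
      (fun x => mul_nonneg hN (hp0 _)) (by fun_prop) ?_ ?_
    · filter_upwards [h, ae_restrict_mem hΩo.measurableSet] with x hx hxΩ
      exact hx.trans ((mul_le_mul_of_nonneg_left (hpR _ (hΩR x hxΩ)).1 hN).trans_eq (mul_comm _ _))
    · intro φ hφ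
      have e : ∀ x, matForm B (gradient (fun x : E d => N * p (x i)) x) (gradient φ x)
          = ∑ k, B k i * N * (p' (x i) * gradient φ x k) := by
        intro x
        rw [gradient_comp_coord hpd]
        refine Finset.sum_congr rfl fun k _ => ?_
        rw [Finset.sum_eq_single i]
        · simp; ring
        · intro j _ hj; simp [hj]
        · simp
      have hp'c : Continuous p' := continuous_iff_continuousAt.2 fun t => (hpd' t).continuousAt
      simp only [e]
      rw [integral_finsetSum]
      · simp only [integral_const_mul, integral_comp_coord_mul_gradient hpd' hp''c hφ, ite_mul,
          zero_mul, mul_assoc]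
        rw [Finset.sum_eq_single i]
        · simp; ring
        · intro j _ hj; simp [hj]
        · simp
      · intro k _
        have h1 : MemLp (fun x : E d => p' (x i)) 2 (volume.restrict Ω) :=
          memLp_restrict_of_continuousOn hΩo hΩb (hp'c.comp hci).continuousOn
        exact (h1.integrable_mul (memLp_coord (hφ.memLp_gradient _) k)).const_mul _
    · filter_upwards [hF, ae_restrict_mem hΩo.measurableSet] with x hx hxΩ
      have := mul_le_mul_of_nonneg_left (hpR _ (hΩR x hxΩ)).2 hN
      linarith
  intro F w g N hN hw hF
  filter_upwards [key F w g N hN hw (hF.mono fun x hx => (le_abs_self _).trans hx),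
    key _ _ _ N hN hw.neg (hF.mono fun x hx => (neg_le_abs _).trans hx)] with x h1 h2
  exact abs_le'.2 ⟨h1, h2⟩

/-! ### The iteration -/

lemma IsRegularization.sub_mem_Icc {F G : ℝ → ℝ} {δ₀ δ₁ σ K γ : ℝ}
    (h : IsRegularization F δ₀ δ₁ σ K γ G) {x y : ℝ} (hxy : x ≤ y) :
    G y - G x ∈ Set.Icc 0 (δ₁ * (y - x)) :=
  ⟨sub_nonneg.2 (monotone_of_deriv_nonneg h.differentiable
    (fun t => h.pos.le.trans (h.le_deriv t)) hxy),
    image_sub_le_mul_sub_of_deriv_le h.differentiable h.deriv_le hxy⟩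

/-- The slope of `t ↦ M t - G t` lies between `M - δ₁ ≥ 0` and `M`; this is what the stabilization
`M ≥ δ₁` is for. -/
lemma IsRegularization.abs_mul_sub_sub_le {F G : ℝ → ℝ} {δ₀ δ₁ σ K γ M : ℝ}
    (h : IsRegularization F δ₀ δ₁ σ K γ G) (hM : δ₁ ≤ M) (x y : ℝ) :
    |M * (x - y) - (G x - G y)| ≤ M * |x - y| := by
  wlog hxy : y ≤ x generalizing x y
  · have := this y x (le_of_not_ge hxy)
    rw [abs_sub_comm x y, ← abs_neg]
    convert this using 2
    ring
  obtain ⟨h0, h1⟩ := h.sub_mem_Icc hxy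
  have h2 := mul_le_mul_of_nonneg_right hM (sub_nonneg.2 hxy)
  rw [abs_of_nonneg (sub_nonneg.2 hxy), abs_of_nonneg (by linarith)]
  linarith

lemma IsRegularization.memLp_comp {F G : ℝ → ℝ} {δ₀ δ₁ σ K γ : ℝ}
    (h : IsRegularization F δ₀ δ₁ σ K γ G) {α : Type*} [MeasurableSpace α] {μ : Measure α}
    [IsFiniteMeasure μ] {u : α → ℝ} (hu : MemLp u 2 μ) : MemLp (fun x => G (u x)) 2 μ := by
  refine ((memLp_const |G 0|).add (hu.norm.const_mul δ₁)).mono'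
    (h.differentiable.continuous.comp_aestronglyMeasurable hu.1) (Eventually.of_forall fun x => ?_)
  have h1 : |G (u x) - G 0| ≤ δ₁ * |u x| := by
    rcases le_total 0 (u x) with h0 | h0
    · have := h.sub_mem_Icc h0
      rw [abs_of_nonneg this.1, abs_of_nonneg h0]
      simpa using this.2
    · have := h.sub_mem_Icc h0
      rw [abs_sub_comm, abs_of_nonneg this.1, abs_of_nonpos h0]
      simpa using this.2
  have h2 := abs_add_le (G (u x) - G 0) (G 0)
  rw [sub_add_cancel] at h2
  change |G (u x)| ≤ |G 0| + δ₁ * |u x|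
  linarith

/-- The right-hand side of the macroscopic problem. -/
def macroRhs {d : ℕ} (m M : ℝ) (f : E d → ℝ) (G : ℝ → ℝ) (v : E d → ℝ) (x : E d) : ℝ :=
  m * f x + M * m * v x - m * G (v x)

lemma IsMacroIteration.memLp {d : ℕ} {Ω : Set (E d)} {A0 : Matrix (Fin d) (Fin d) ℝ} {m M : ℝ}
    {f : E d → ℝ} {Rk : ℕ → ℝ → ℝ} {u : ℕ → E d → ℝ} (h : IsMacroIteration Ω A0 m M f Rk u)
    (k : ℕ) : MemLp (u k) 2 (volume.restrict Ω) := by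
  rcases Nat.eq_zero_or_pos k with rfl | hk
  · exact (memLp_congr_ae h.1).2 MemLp.zero
  · obtain ⟨g, hg, -⟩ := h.2 k hk
    exact hg.1

lemma IsMacroIteration.isWeakSolution {d : ℕ} {Ω : Set (E d)} {A0 : Matrix (Fin d) (Fin d) ℝ}
    {m M : ℝ} {f : E d → ℝ} {Rk : ℕ → ℝ → ℝ} {u : ℕ → E d → ℝ}
    (h : IsMacroIteration Ω A0 m M f Rk u) (hf : MemLp f 2 (volume.restrict Ω)) (k : ℕ)
    (hR : MemLp (fun x => Rk (k + 1) (u k x)) 2 (volume.restrict Ω)) :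
    ∃ g, IsWeakSolution Ω A0 (M * m) (macroRhs m M f (Rk (k + 1)) (u k)) (u (k + 1)) g := by
  obtain ⟨g, hg, hw⟩ := h.2 (k + 1) (by omega)
  have hu := h.memLp k
  refine ⟨g, hg, ((hf.const_mul m).add (hu.const_mul (M * m))).sub (hR.const_mul m),
    fun φ hφ => ?_⟩
  have hφ2 : MemLp φ 2 (volume.restrict Ω) := hφ.memLp _
  refine (hw φ _ hφ.memH10).trans ?_
  simp only [macroRhs, sub_mul, add_mul]
  rw [integral_sub, integral_add]
  · simp only [mul_assoc, integral_const_mul, Nat.add_sub_cancel]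
  · exact (hf.const_mul m).integrable_mul hφ2
  · exact (hu.const_mul (M * m)).integrable_mul hφ2
  · exact ((hf.const_mul m).integrable_mul hφ2).add ((hu.const_mul (M * m)).integrable_mul hφ2)
  · exact (hR.const_mul m).integrable_mul hφ2

/-- The change of argument is handled with `G` fixed, by the slope bound; the change from `G` to
`G'` is made at the single point `v' x`, passing through `R`. -/
lemma abs_macroRhs_sub_le {d : ℕ} {m M δ₀ δ₁ σ K γ γ' : ℝ} (hm : 0 ≤ m) (hM : 0 < M)
    (hδM : δ₁ ≤ M) {R G G' : ℝ → ℝ} (hG : IsRegularization R δ₀ δ₁ σ K γ G)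
    (hG' : IsRegularization R δ₀ δ₁ σ K γ' G') (f v v' : E d → ℝ) {a : ℝ} (x : E d)
    (ha : |v x - v' x| ≤ a) :
    |macroRhs m M f G v x - macroRhs m M f G' v' x|
      ≤ M * m * (a + (K * γ ^ σ + K * γ' ^ σ) / M) := by
  have e : macroRhs m M f G v x - macroRhs m M f G' v' x
      = m * ((M * (v x - v' x) - (G (v x) - G (v' x)))
        + ((R (v' x) - G (v' x)) - (R (v' x) - G' (v' x)))) := by
    simp only [macroRhs]; ring
  have h1 := hG.abs_mul_sub_sub_le hδM (v x) (v' x)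
  have h2 := hG.approx (v' x)
  have h3 := hG'.approx (v' x)
  have h4 : M * |v x - v' x| ≤ M * a := by gcongr
  rw [e, abs_mul, abs_of_nonneg hm]
  calc _ ≤ m * (M * a + (K * γ ^ σ + K * γ' ^ σ)) := by
        refine mul_le_mul_of_nonneg_left ?_ hm
        refine (abs_add_le _ _).trans (add_le_add (h1.trans h4) ?_)
        exact (abs_sub _ _).trans (add_le_add h2 h3)
    _ = _ := by field_simp

/-- A linear recursion with contraction factor `ρ < 1` inherits the polynomial decay of its
inhomogeneity. -/
lemma exists_le_div_rpow_of_recursion {ρ D σ : ℝ} (hρ0 : 0 ≤ ρ) (hρ1 : ρ < 1) (hD : 0 ≤ D)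
    {b : ℕ → ℝ} (hb : ∀ k : ℕ, 1 ≤ k → b (k + 1) ≤ ρ * (b k + D / ((k : ℝ) + 1) ^ σ)) :
    ∃ C : ℝ, 0 < C ∧ ∀ k : ℕ, 1 ≤ k → b k ≤ C / ((k : ℝ) + 1) ^ (σ - 1) := by
  set s := σ - 1
  -- Weighted by `(k+1)^s`, the inhomogeneity stays below `D`, and the contraction factor becomes `r
  -- k`, which still tends to `ρ < 1`.
  set q : ℕ → ℝ := fun k => b k * ((k : ℝ) + 1) ^ s
  set r : ℕ → ℝ := fun k => ρ * (1 + 1 / ((k : ℝ) + 1)) ^ s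
  have hr0 : ∀ k, 0 ≤ r k := fun k => by positivity
  have hrec : ∀ k : ℕ, 1 ≤ k → q (k + 1) ≤ r k * (q k + D) := by
    intro k hk
    have hk0 : (0 : ℝ) < (k : ℝ) + 1 := by positivity
    have h1 : ((k + 1 : ℕ) : ℝ) + 1 = (1 + 1 / ((k : ℝ) + 1)) * ((k : ℝ) + 1) := by
      push_cast; field_simp
    have h2 : (((k + 1 : ℕ) : ℝ) + 1) ^ s = (1 + 1 / ((k : ℝ) + 1)) ^ s * ((k : ℝ) + 1) ^ s := by
      rw [h1, Real.mul_rpow (by positivity) hk0.le]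
    have h3 : D / ((k : ℝ) + 1) ^ σ * ((k : ℝ) + 1) ^ s ≤ D := by
      rw [div_mul_eq_mul_div, mul_div_assoc, ← Real.rpow_sub hk0]
      have : s - σ = -1 := by simp [s]
      rw [this, Real.rpow_neg_one]
      exact mul_le_of_le_one_right hD (inv_le_one_of_one_le₀ (by linarith [Nat.cast_nonneg (α := ℝ) k]))
    calc q (k + 1) ≤ ρ * (b k + D / ((k : ℝ) + 1) ^ σ) * (((k + 1 : ℕ) : ℝ) + 1) ^ s :=
          mul_le_mul_of_nonneg_right (hb k hk) (by positivity)
      _ = r k * (q k + D / ((k : ℝ) + 1) ^ σ * ((k : ℝ) + 1) ^ s) := by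
          rw [h2]; simp only [r, q]; ring
      _ ≤ _ := mul_le_mul_of_nonneg_left (by linarith) (hr0 k)
  have hlim : Tendsto r atTop (𝓝 ρ) := by
    have h1 : Tendsto (fun k : ℕ => 1 + 1 / ((k : ℝ) + 1)) atTop (𝓝 1) := by
      simpa using tendsto_one_div_add_atTop_nhds_zero_nat.const_add (1 : ℝ)
    simpa [r] using (h1.rpow_const (p := s) (Or.inl one_ne_zero)).const_mul ρ
  obtain ⟨ρ', hρ', hρ'1⟩ := exists_between hρ1
  obtain ⟨n, hn⟩ := eventually_atTop.1 (hlim.eventually_le_const hρ')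
  -- Large enough to dominate the initial values and to be stable under `y ↦ ρ' (y + D)`. The range
  -- `n + 2` leaves to the recursion only indices with `k ≥ n` and `k ≥ 1`.
  set C := (∑ k ∈ Finset.range (n + 2), |q k|) + D / (1 - ρ') + 1
  have h1ρ : 0 < 1 - ρ' := by linarith
  have hC : 0 < C := by positivity
  have hC' : ρ' * (C + D) ≤ C := by
    have h1 : D / (1 - ρ') ≤ C := by
      have : 0 ≤ ∑ k ∈ Finset.range (n + 2), |q k| := by positivity
      simp only [C]; linarith
    rw [div_le_iff₀ h1ρ] at h1
    nlinarith
  have hsmall : ∀ k, k < n + 2 → q k ≤ C := by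
    intro k hk
    have h1 := Finset.single_le_sum (f := fun k => |q k|) (fun _ _ => abs_nonneg _)
      (Finset.mem_range.2 hk)
    have h2 : 0 ≤ D / (1 - ρ') := by positivity
    simp only [C]
    linarith [le_abs_self (q k)]
  have hq : ∀ k, q k ≤ C := by
    intro k
    induction k with
    | zero => exact hsmall 0 (by omega)
    | succ k ih =>
      rcases lt_or_ge (k + 1) (n + 2) with h | h
      · exact hsmall _ h
      · refine (hrec k (by omega)).trans ?_
        have h1 : r k * (q k + D) ≤ r k * (C + D) :=
          mul_le_mul_of_nonneg_left (by linarith) (hr0 k)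
        have h2 : r k * (C + D) ≤ ρ' * (C + D) :=
          mul_le_mul_of_nonneg_right (hn k (by omega)) (by positivity)
        linarith
  refine ⟨C, hC, fun k _ => ?_⟩
  rw [le_div_iff₀ (by positivity)]
  exact hq k

end MacroScheme

open MacroScheme

theorem mainTheorem7
    {d : ℕ} (hd : d = 2 ∨ d = 3)
    (Ω : Set (MacroScheme.E d)) (hΩo : IsOpen Ω) (hΩc : IsConnected Ω)
    (hΩb : Bornology.IsBounded Ω)
    (Ys : Set (MacroScheme.E d)) (hYs : MacroScheme.IsAdmissibleCell Ys)
    (A : MacroScheme.E d → Matrix (Fin d) (Fin d) ℝ) (hA : MacroScheme.IsDiffusion A)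
    (χ : Fin d → MacroScheme.E d → ℝ) (gχ : Fin d → MacroScheme.E d → MacroScheme.E d)
    (hχ : ∀ i, MacroScheme.IsCellSolution A Ys i (χ i) (gχ i))
    (R : ℝ → ℝ) (x₀ δ₀ δ₁ : ℝ) (hR : MacroScheme.IsDegenerateAt R x₀ δ₀ δ₁)
    (f : MacroScheme.E d → ℝ) (hf : ContDiffOn ℝ ∞ f (closure Ω))
    (η : ℝ) (hη : 0 < η) (σ : ℝ) (hσ : 1 < σ)
    (γ : ℕ → ℝ) (hγ : ∃ c : ℝ, 0 < c ∧ ∀ k : ℕ, 1 ≤ k → γ k = c / ((k : ℝ) + 1))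
    (Rγ : ℝ → ℝ → ℝ)
    (hReg : ∃ K : ℝ, ∀ k : ℕ, 1 ≤ k →
      MacroScheme.IsRegularization R δ₀ δ₁ σ K (γ k) (Rγ (γ k)))
    (hRsmooth : ∀ k : ℕ, 1 ≤ k → ContDiff ℝ ∞ (Rγ (γ k))) :
    ∃ C : ℝ, 0 < C ∧ ∀ u : ℕ → MacroScheme.E d → ℝ,
      MacroScheme.IsMacroIteration Ω (MacroScheme.homogenized A Ys gχ)
        (volume.real (MacroScheme.fluidCell Ys)) (η + δ₁) f (fun k => Rγ (γ k)) u →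
      ∀ k : ℕ, 1 ≤ k →
        eLpNorm (fun x => u k x - u (k - 1) x) ⊤ (volume.restrict Ω)
          ≤ ENNReal.ofReal (C / ((k : ℝ) + 1) ^ (σ - 1)) := by
  obtain ⟨c, hc, hγ⟩ := hγ
  obtain ⟨K, hReg⟩ := hReg
  -- Any coordinate direction serves for the barrier.
  have i : Fin d := ⟨0, by omega⟩
  set A0 := homogenized A Ys gχ
  set m := volume.real (fluidCell Ys)
  have hm : 0 < m := volume_real_fluidCell_pos hYs
  set M := η + δ₁
  have hM : 0 < M := add_pos hη hR.pos₁
  have hδM : δ₁ ≤ M := by simp only [M]; linarith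
  obtain ⟨ρ, hρ0, hρ1, hcontr⟩ := exists_contraction hΩo hΩb (B := A0)
    (homogenized_nonneg hA hχ) i (homogenized_diag_pos hYs hA hχ i) (mul_pos hM hm)
  have := isFiniteMeasure_restrict_of_isBounded hΩb
  have hf2 : MemLp f 2 (volume.restrict Ω) :=
    memLp_restrict_of_continuousOn hΩo hΩb hf.continuousOn
  obtain ⟨Cf, hCf⟩ := hΩb.isCompact_closure.exists_bound_of_continuousOn hf.continuousOn
  have hγpos : ∀ k : ℕ, 1 ≤ k → 0 < γ k := fun k hk => by rw [hγ k hk]; positivity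
  have hK : 0 ≤ K := by
    have h := (abs_nonneg _).trans ((hReg 1 le_rfl).approx 0)
    exact nonneg_of_mul_nonneg_left h (Real.rpow_pos_of_pos (hγpos 1 le_rfl) σ)
  set D := 2 * K * c ^ σ / M
  have hD : 0 ≤ D := by positivity
  have hDk : ∀ k : ℕ, 1 ≤ k →
      (K * γ (k + 1) ^ σ + K * γ k ^ σ) / M ≤ D / ((k : ℝ) + 1) ^ σ := by
    intro k hk
    have h1 : γ (k + 1) ≤ γ k := by
      rw [hγ k hk, hγ (k + 1) (by omega)]
      push_cast
      gcongr
      linarith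
    have h2 : γ (k + 1) ^ σ ≤ γ k ^ σ :=
      Real.rpow_le_rpow (hγpos _ (by omega)).le h1 (by linarith)
    have h3 : γ k ^ σ = c ^ σ / ((k : ℝ) + 1) ^ σ := by
      rw [hγ k hk, Real.div_rpow hc.le (by positivity)]
    calc (K * γ (k + 1) ^ σ + K * γ k ^ σ) / M ≤ (K * γ k ^ σ + K * γ k ^ σ) / M := by gcongr
      _ = D / ((k : ℝ) + 1) ^ σ := by rw [h3]; simp only [D]; field_simp; ring
  -- Size of the first right-hand side divided by `κ`: since `u 0 = 0`, that side is `m (f -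
  -- 𝓡_{γ₁}(0))`.
  set N₁ := (|Cf| + |Rγ (γ 1) 0|) / M
  -- The majorant is fixed before `u` is introduced, so the constant does not depend on the
  -- iteration. The value at 0 is a dummy; the recursion really starts from `b 1 = ρ N₁`.
  set b : ℕ → ℝ := fun k => Nat.rec 0 (fun k y => if k = 0 then ρ * N₁ else
    ρ * (y + D / ((k : ℝ) + 1) ^ σ)) k
  have hb1 : b 1 = ρ * N₁ := rfl
  have hbs : ∀ k : ℕ, 1 ≤ k → b (k + 1) = ρ * (b k + D / ((k : ℝ) + 1) ^ σ) := fun k hk =>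
    if_neg (by omega)
  have hb0 : ∀ k : ℕ, 1 ≤ k → 0 ≤ b k := by
    intro k hk
    induction k, hk using Nat.le_induction with
    | base => rw [hb1]; positivity
    | succ k hk ih => rw [hbs k hk]; positivity
  obtain ⟨C, hC, hbC⟩ := exists_le_div_rpow_of_recursion hρ0 hρ1 hD (fun k hk => (hbs k hk).le)
  refine ⟨C, hC, fun u hu k hk => ?_⟩
  have hsol := fun k => hu.isWeakSolution hf2 k
    ((hReg (k + 1) (by omega)).memLp_comp (hu.memLp k))
  have main : ∀ k : ℕ, 1 ≤ k → ∀ᵐ x ∂volume.restrict Ω, |u k x - u (k - 1) x| ≤ b k := by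
    intro k hk
    induction k, hk using Nat.le_induction with
    | base =>
      obtain ⟨g, hg⟩ := hsol 0
      have h := hcontr _ _ _ N₁ (by positivity) hg (by
        filter_upwards [hu.1, ae_restrict_mem hΩo.measurableSet] with x hx hxΩ
        have h1 : |f x| ≤ |Cf| := (hCf x (subset_closure hxΩ)).trans (le_abs_self _)
        have h2 : macroRhs m M f (Rγ (γ (0 + 1))) (u 0) x = m * (f x - Rγ (γ 1) 0) := by
          simp [macroRhs, hx]; ring
        rw [h2, abs_mul, abs_of_pos hm]
        calc m * |f x - Rγ (γ 1) 0| ≤ m * (|Cf| + |Rγ (γ 1) 0|) := by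
              gcongr; exact (abs_sub _ _).trans (by gcongr)
          _ = M * m * N₁ := by simp only [N₁]; field_simp)
      filter_upwards [h, hu.1] with x hx h0
      simpa [h0, hb1] using hx
    | succ k hk ih =>
      -- Makes the predecessor explicit, so that the equations of both consecutive iterates can be
      -- subtracted.
      obtain ⟨k, rfl⟩ : ∃ l, k = l + 1 := ⟨k - 1, by omega⟩
      obtain ⟨g, hg⟩ := hsol (k + 1)
      obtain ⟨g', hg'⟩ := hsol k
      have h := hcontr _ _ _ (b (k + 1) + D / (((k + 1 : ℕ) : ℝ) + 1) ^ σ)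
        (add_nonneg (hb0 _ hk) (by positivity)) (hg.sub hg') (by
          filter_upwards [ih] with x hx
          refine (abs_macroRhs_sub_le hm.le hM hδM (hReg (k + 1 + 1) (by omega)) (hReg (k + 1) hk)
            f (u (k + 1)) (u k) x hx).trans ?_
          exact mul_le_mul_of_nonneg_left (by linarith [hDk (k + 1) hk]) (by positivity))
      filter_upwards [h] with x hx
      rw [hbs (k + 1) hk]
      exact hx
  rw [eLpNorm_exponent_top]
  refine (eLpNormEssSup_le_of_ae_bound (main k hk)).trans (ENNReal.ofReal_le_ofReal (hbC k hk))
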